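/- **Setting.** Let $U$ be a compact metric space, $Y\subset\mathbb R^m$ and $Z\subset\mathbb R^n$ compact, $C>0$, and let $f:U\times\mathbb R^m\times\mathbb R^n\to\mathbb R^m$, $g:U\times\mathbb R^m\times\mathbb R^n\to\mathbb R^n$, $G:U\times\mathbb R^m\times\mathbb R^n\to\mathbb R$ be continuous, with $f,g$ Lipschitz in $(y,z)$ uniformly in $u$. For $\epsilon>0$ consider the singularly perturbed (SP) system $$\epsilon y'(t)=f(u(t),y(t),z(t)),\qquad z'(t)=g(u(t),y(t),z(t)),\qquad (y(0),z(0))=(y_0,z_0),$$ with measurable controls $u:[0,\infty)\to U$ (solutions of all equations are absolutely continuous and the equations hold a.e.). Assume that, for small $\epsilon$, all solutions stay in $Y\times Z$. Put $$V^*_{di}(\epsilon)=\inf_{u(\cdot)}\int_0^\infty e^{-Ct}G(u(t),y_\epsilon(t),z_\epsilon(t))\,dt .$$ *Associated system.* For $z\in Z$, an admissible pair of the associated system is a measurable $u:[0,\infty)\to U$ together with an absolutely continuous $y:[0,\infty)\to Y$ such that $y'(\tau)=f(u(\tau),y(\tau),z)$ a.e. Let $\mathcal P(X)$ denote the Borel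 probability measures on $X$. The occupational measure of a measurable $w:[0,\infty)\to X$ on $[0,S]$ is $Q\mapsto S^{-1}\int_0^S 1_Q(w(t))\,dt$; the occupational measure on $[0,\infty)$ is the weak limit as $S\to\infty$, if it exists. Fix $\rho(\gamma,\gamma')=\sum_{l\ge1}2^{-l}|\int q_l\,d\gamma-\int q_l\,d\gamma'|$, where $(q_l)$ is a sequence of Lipschitz functions dense in the unit ball of $C(U\times Y)$. For $\mu\in\mathcal P(U\times Y)$ and a function $q(u,y,z)$ write $\tilde q(\mu,z)=\int_{U\times Y}q(u,y,z)\,\mu(du,dy)$. *Averaged problem.* Let $W(z)$ be the set of $\mu\in\mathcal P(U\times Y)$ with $\int\nabla\phi(y)^Tf(u,y,z)\,\mu(du,dy)=0$ for all $\phi\in C^1(\mathbb R^m)$, and let $F=\{(\mu,z):z\in Z,\ \mu\in W(z)\}$. Define $$\tilde V^*_{di}(z_0)=\inf\int_0^\infty e^{-Ct}\tilde G(\mu(t),z(t))\,dt$$ over measurable $\mu(\cdot)$ and absolutely continuous $z(\cdot)$ with values in $Z$ such that $z'=\tilde g(\mu(t),z(t))$ and $\mu(t)\in W(z(t))$ for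 a.e. $t$, and $z(0)=z_0$. Define $\tilde G^*_{di}(z_0)=\inf\int_F\tilde G\,dp$ over those $p\in\mathcal P(F)$ with $\int_F\big(\nabla\psi(z)^T\tilde g(\mu,z)+C(\psi(z_0)-\psi(z))\big)\,p(d\mu,dz)=0$ for all $\psi\in C^1(\mathbb R^n)$. *ACG families.* An average control generating (ACG) family consists of admissible pairs $(u_z(\cdot),y_z(\cdot))$ of the associated system, $z\in Z$, having occupational measures $\mu(\cdot|z)$ on $[0,\infty)$ such that, for every continuous $q(u,y,z)$, the function $\tilde q_\mu(z):=\tilde q(\mu(\cdot|z),z)$ is measurable on $Z$ and $|S^{-1}\int_0^Sq(u_z(\tau),y_z(\tau),z)\,d\tau-\tilde q_\mu(z)|\le\phi_q(S)$ for all $z\in Z$, $S>0$, with $\phi_q(S)\to0$ as $S\to\infty$; and such that $z'=\tilde g_\mu(z)$, $z(0)=z_0$, has a unique solution $z(\cdot)$ with values in $Z$ on $[0,\infty)$. The family is optimal if $\int_0^\infty e^{-Ct}\tilde G_\mu(z(t))\,dt=\tilde V^*_{di}(z_0)$, and $\alpha$-near optimal ($\alpha>0$) if this integral is $\le\tilde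 V^*_{di}(z_0)+\alpha$. *Piecewise Lipschitz continuity.* A function $h$ on $Z$ is piecewise Lipschitz continuous near $z(\cdot)$ if for every $T>0$ there are finitely many $\bar t_i\in[0,T]$, radii $a_t>0$ ($t\in[0,T]$, $t\ne\bar t_i$) and a constant $K$ such that $h$ is $K$-Lipschitz on $Z\cap(z(t)+a_tB)$ for every $t\neq\bar t_i$ ($B$ the open unit ball), and such that for every $\delta>0$ the $a_t$ with $t\in[0,T]\setminus\bigcup_i(\bar t_i-\delta,\bar t_i+\delta)$ are bounded below by a positive number. **Statement.** Suppose that $(u_z(\cdot),y_z(\cdot))$ is an ACG family, with $\mu(\cdot|z)$ and $z(\cdot)$ as above, and: 1. (uniform attainability) for all $y\in Y$, $z\in Z$ there is an admissible pair $(u_{y,z}(\cdot),y_{y,z}(\cdot))$ of the associated system with $y_{y,z}(0)=y$ whose occupational measure on $[0,S]$ is within $\rho$-distance $\phi(S)$ of $\mu(\cdot|z)$, where $\phi$ does not depend on $(y,z)$ and $\phi(S)\to0$ as $S\to\infty$; 2. (weak piecewise Lipschitz continuity) $\tilde q_\mu$ for every Lipschitz $q(u,y,z)$, and $\tilde g_\mu$,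 are piecewise Lipschitz continuous near $z(\cdot)$; 3. $L_f>0$ is a Lipschitz constant of $f$ in $(y,z)$ on $Y\times Z$, $\Delta(\epsilon)=\frac{\epsilon}{2L_f}\ln\frac1\epsilon$, $t_l=l\Delta(\epsilon)$, and for small $\epsilon>0$ the control $u_\epsilon(\cdot)$, with the corresponding solution $(y_\epsilon(\cdot),z_\epsilon(\cdot))$ of the SP system, is the one constructed successively by $$u_\epsilon(t)=u_{y_\epsilon(t_l),z_\epsilon(t_l)}\Big(\frac{t-t_l}{\epsilon}\Big),\qquad t\in[t_l,t_{l+1}),\quad l=0,1,\dots;$$ 4. for every $T>0$ there are $\bar t_i$ and $a_t$ as in the definition of the piecewise Lipschitz continuity of $\tilde g_\mu$, and $\bar\delta_T(\epsilon)>0$ with $\bar\delta_T(\epsilon)\to0$ as $\epsilon\to0$, such that for small $\epsilon$, $z_\epsilon(t)\in z(t)+a_tB$ for all $t\in[0,T]\setminus\bigcup_i(\bar t_i-\bar\delta_T(\epsilon),\bar t_i+\bar\delta_T(\epsilon))$; 5. $\lim_{\epsilon\to0}V^*_{di}(\epsilon)=\tilde V^*_{di}(z_0)$ or $C\,\tilde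 V^*_{di}(z_0)=\tilde G^*_{di}(z_0)$. If the ACG family is optimal, then $u_\epsilon$ is asymptotically optimal: both limits below exist and $$\lim_{\epsilon\to0}\int_0^\infty e^{-Ct}G(u_\epsilon(t),y_\epsilon(t),z_\epsilon(t))\,dt=\lim_{\epsilon\to0}V^*_{di}(\epsilon).$$ If, for some $\alpha>0$, the ACG family is $\alpha$-near optimal, then $u_\epsilon$ is asymptotically $\alpha$-near optimal: the limit on the left exists and $$\lim_{\epsilon\to0}\int_0^\infty e^{-Ct}G(u_\epsilon(t),y_\epsilon(t),z_\epsilon(t))\,dt\le\liminf_{\epsilon\to0}V^*_{di}(\epsilon)+\alpha .$$ -/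

import Mathlib

open MeasureTheory Filter Topology Set
open scoped NNReal ENNReal

noncomputable section

/-- Euclidean space of dimension `k`. -/
abbrev Euc (k : ℕ) := EuclideanSpace ℝ (Fin k)

/-- `x` is a Carathéodory solution on `[0, ∞)` of `x'(t) = v(t)`: `v` is locally integrable and `x`
is its indefinite integral (equivalently, `x` is locally absolutely continuous and `x' = v`
almost everywhere). -/
def HasVelocity {k : ℕ} (x v : ℝ → Euc k) : Prop :=
  ∀ t : ℝ, 0 ≤ t → IntervalIntegrable v volume 0 t ∧ x t = x 0 + ∫ s in (0 : ℝ)..t, v s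

section Occupational

variable {W : Type*} [TopologicalSpace W] [MeasurableSpace W]

/-- The occupational measure of `w` on `[0, S]`: `Q ↦ S⁻¹ ∫₀ˢ 1_Q (w t) dt`. -/
def occupOn (w : ℝ → W) (S : ℝ) : Measure W :=
  (ENNReal.ofReal S)⁻¹ • (volume.restrict (Icc 0 S)).map w

/-- `γ` is the occupational measure generated by `w` on `[0, ∞)`:
the time averages of every continuous function along `w` converge to its integral. -/
def IsOccupational (w : ℝ → W) (γ : ProbabilityMeasure W) : Prop :=
  ∀ q : W → ℝ, Continuous q →
    Tendsto (fun S : ℝ => S⁻¹ * ∫ t in (0 : ℝ)..S, q (w t)) atTop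
      (𝓝 (∫ w, q w ∂(γ : Measure W)))

/-- The metric `ρ(γ, γ') = ∑ₗ 2⁻ˡ |∫ qₗ dγ - ∫ qₗ dγ'|` (sum over `l ≥ 1`) built on a sequence of
test functions (here numbered from `0`). -/
def rhoDist (q : ℕ → W → ℝ) (γ γ' : Measure W) : ℝ :=
  ∑' l : ℕ, (1 / 2 : ℝ) ^ (l + 1) * |(∫ w, q l w ∂γ) - ∫ w, q l w ∂γ'|

end Occupational

/-- `q` is a sequence of Lipschitz functions of sup norm at most one that is dense in the unit ball
of the space of continuous functions on `W`. -/
def IsTestSequence {W : Type*} [PseudoMetricSpace W] (q : ℕ → W → ℝ) : Prop :=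
  (∀ l, ∃ K : ℝ≥0, LipschitzWith K (q l)) ∧
  (∀ l w, |q l w| ≤ 1) ∧
  ∀ h : W → ℝ, Continuous h → (∀ w, |h w| ≤ 1) →
    ∀ η : ℝ, 0 < η → ∃ l, ∀ w, |q l w - h w| ≤ η

/-- `h` is Lipschitz on the part of the tube around `z` on `[0, T]` given by the open balls of
radius `a t` about `z t`, for `t` outside of the finite set `s`; the radii are
bounded away from zero off each neighbourhood of `s`. (Balls are taken in the domain `Z` of `h`.) -/
def PiecewiseLipschitzTube {Z V : Type*} [PseudoMetricSpace Z] [PseudoMetricSpace V]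
    (h : Z → V) (z : ℝ → Z) (T : ℝ) (s : Finset ℝ) (a : ℝ → ℝ) : Prop :=
  (∀ x ∈ s, x ∈ Icc 0 T) ∧
  (∀ t ∈ Icc 0 T, t ∉ s → 0 < a t) ∧
  (∃ K : ℝ≥0, ∀ t ∈ Icc 0 T, t ∉ s → LipschitzOnWith K h (Metric.ball (z t) (a t))) ∧
  ∀ δ : ℝ, 0 < δ → ∃ r : ℝ, 0 < r ∧
    ∀ t ∈ Icc 0 T, (∀ x ∈ s, t ∉ Ioo (x - δ) (x + δ)) → r ≤ a t

/-- Piecewise Lipschitz continuity of `h` in a neighbourhood of `z`. -/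
def IsPiecewiseLipschitzNear {Z V : Type*} [PseudoMetricSpace Z] [PseudoMetricSpace V]
    (h : Z → V) (z : ℝ → Z) : Prop :=
  ∀ T : ℝ, 0 < T → ∃ (s : Finset ℝ) (a : ℝ → ℝ), PiecewiseLipschitzTube h z T s a

/-- The data of a singularly perturbed optimal control problem: the right-hand sides, the running
cost, the state constraint sets, the initial state and the discount rate. -/
structure SPProblem (U : Type*) (m n : ℕ) where
  f : U × Euc m × Euc n → Euc m
  g : U × Euc m × Euc n → Euc n
  G : U × Euc m × Euc n → ℝ
  Y : Set (Euc m)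
  Z : Set (Euc n)
  y0 : Euc m
  z0 : Euc n
  C : ℝ

namespace SPProblem

variable {U : Type*} {m n : ℕ} [MetricSpace U] [MeasurableSpace U]

/-- `(u, y, z)` is a control together with a solution of `ε y' = f(u,y,z)`, `z' = g(u,y,z)`,
`(y(0), z(0)) = (y0, z0)`. -/
def IsSPTriple (P : SPProblem U m n) (ε : ℝ) (u : ℝ → U) (y : ℝ → Euc m) (z : ℝ → Euc n) : Prop :=
  Measurable u ∧ y 0 = P.y0 ∧ z 0 = P.z0 ∧
  HasVelocity y (fun t => ε⁻¹ • P.f (u t, y t, z t)) ∧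
  HasVelocity z (fun t => P.g (u t, y t, z t))

/-- The discounted cost. -/
def cost (P : SPProblem U m n) (u : ℝ → U) (y : ℝ → Euc m) (z : ℝ → Euc n) : ℝ :=
  ∫ t in Ioi (0 : ℝ), Real.exp (-(P.C * t)) * P.G (u t, y t, z t)

/-- The optimal value `V*_di(ε, y0, z0)` of the singularly perturbed problem. -/
def value (P : SPProblem U m n) (ε : ℝ) : ℝ :=
  sInf {c : ℝ | ∃ u y z, P.IsSPTriple ε u y z ∧ c = P.cost u y z}

/-- The standing assumptions on a singularly perturbed problem. -/
structure Standing (P : SPProblem U m n) : Prop where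
  f_cont : Continuous P.f
  g_cont : Continuous P.g
  G_cont : Continuous P.G
  f_lip : ∃ K : ℝ≥0, ∀ u, LipschitzWith K (fun x : Euc m × Euc n => P.f (u, x))
  g_lip : ∃ K : ℝ≥0, ∀ u, LipschitzWith K (fun x : Euc m × Euc n => P.g (u, x))
  Y_compact : IsCompact P.Y
  Z_compact : IsCompact P.Z
  C_pos : 0 < P.C
  invariant : ∀ᶠ ε in 𝓝[>] (0 : ℝ), ∀ u y z, P.IsSPTriple ε u y z →
    ∀ t : ℝ, 0 ≤ t → y t ∈ P.Y ∧ z t ∈ P.Z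

/-- Admissible pairs of the associated system `y' = f(u, y, ζ)`, `ζ` fixed, with `y` in `Y`. -/
def IsAssocAdmissible (P : SPProblem U m n) (ζ : P.Z) (u : ℝ → U) (y : ℝ → P.Y) : Prop :=
  Measurable u ∧
  HasVelocity (fun τ => (y τ : Euc m)) (fun τ => P.f (u τ, (y τ : Euc m), (ζ : Euc n)))

/-- The average `∫ q(u, y, ζ) μ(du, dy)` over `U × Y`. -/
def avg {V : Type*} [NormedAddCommGroup V] [NormedSpace ℝ V] (P : SPProblem U m n)
    (q : U × Euc m × Euc n → V) (μ : ProbabilityMeasure (U × P.Y)) (ζ : P.Z) : V :=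
  ∫ p, q (p.1, (p.2 : Euc m), (ζ : Euc n)) ∂(μ : Measure (U × P.Y))

/-- The set `W(ζ)` of probability measures on `U × Y` with `∫ ∇φ(y)ᵀ f(u, y, ζ) dμ = 0` for every
continuously differentiable `φ`. -/
def limitSet (P : SPProblem U m n) (ζ : P.Z) : Set (ProbabilityMeasure (U × P.Y)) :=
  {μ | ∀ φ : Euc m → ℝ, ContDiff ℝ 1 φ →
    ∫ p, fderiv ℝ φ (p.2 : Euc m) (P.f (p.1, (p.2 : Euc m), (ζ : Euc n)))
      ∂(μ : Measure (U × P.Y)) = 0}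

/-- Admissible pairs of the averaged system `z' = g̃(μ(t), z)`, `μ(t) ∈ W(z(t))`, with `z` in
`Z`. -/
def IsAvgAdmissible (P : SPProblem U m n) (μ : ℝ → ProbabilityMeasure (U × P.Y)) (z : ℝ → P.Z) :
    Prop :=
  Measurable μ ∧
  HasVelocity (fun t => (z t : Euc n)) (fun t => P.avg P.g (μ t) (z t)) ∧
  ∀ᵐ t ∂(volume.restrict (Ici (0 : ℝ))), μ t ∈ P.limitSet (z t)

/-- The discounted cost of a pair of the averaged system. -/
def avgCost (P : SPProblem U m n) (μ : ℝ → ProbabilityMeasure (U × P.Y)) (z : ℝ → P.Z) : ℝ :=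
  ∫ t in Ioi (0 : ℝ), Real.exp (-(P.C * t)) * P.avg P.G (μ t) (z t)

/-- The optimal value `Ṽ*_di(z0)` of the averaged problem. -/
def avgValue (P : SPProblem U m n) : ℝ :=
  sInf {c : ℝ | ∃ μ z, P.IsAvgAdmissible μ z ∧ (z 0 : Euc n) = P.z0 ∧ c = P.avgCost μ z}

/-- The graph `F` of `W(·)`. -/
def graphW (P : SPProblem U m n) : Set (ProbabilityMeasure (U × P.Y) × P.Z) :=
  {x | x.1 ∈ P.limitSet x.2}

/-- The feasible set `D̃_di(z0)` of the averaged infinite-dimensional linear program. -/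
def lpFeasible (P : SPProblem U m n) : Set (ProbabilityMeasure P.graphW) :=
  {p | ∀ ψ : Euc n → ℝ, ContDiff ℝ 1 ψ →
    ∫ x : P.graphW, (fderiv ℝ ψ (x.1.2 : Euc n) (P.avg P.g x.1.1 x.1.2)
      + P.C * (ψ P.z0 - ψ (x.1.2 : Euc n))) ∂(p : Measure P.graphW) = 0}

/-- The optimal value `G̃*_di(z0)` of the averaged infinite-dimensional linear program. -/
def lpValue (P : SPProblem U m n) : ℝ :=
  sInf {c : ℝ | ∃ p ∈ P.lpFeasible,
    c = ∫ x : P.graphW, P.avg P.G x.1.1 x.1.2 ∂(p : Measure P.graphW)}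

/-- `z` is a `Z`-valued solution of `z' = ∫ g(u, y, z) μ(du, dy | z)`, `z(0) = z0`. -/
def IsAvgFlow (P : SPProblem U m n) (μ : P.Z → ProbabilityMeasure (U × P.Y)) (z : ℝ → P.Z) :
    Prop :=
  (z 0 : Euc n) = P.z0 ∧
  HasVelocity (fun t => (z t : Euc n)) (fun t => P.avg P.g (μ (z t)) (z t))

/-- `(uz, yz)` is an average control generating family; `μ` is the family of occupational measures
and `z` the trajectory that it generates. -/
structure IsACGFamily (P : SPProblem U m n) (uz : P.Z → ℝ → U) (yz : P.Z → ℝ → P.Y)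
    (μ : P.Z → ProbabilityMeasure (U × P.Y)) (z : ℝ → P.Z) : Prop where
  admissible : ∀ ζ, P.IsAssocAdmissible ζ (uz ζ) (yz ζ)
  occupational : ∀ ζ, IsOccupational (fun τ => (uz ζ τ, yz ζ τ)) (μ ζ)
  measurable_avg : ∀ q : U × Euc m × Euc n → ℝ, Continuous q →
    Measurable (fun ζ : P.Z => P.avg q (μ ζ) ζ)
  uniform : ∀ q : U × Euc m × Euc n → ℝ, Continuous q →
    ∃ φ : ℝ → ℝ, Tendsto φ atTop (𝓝 0) ∧ ∀ S : ℝ, 0 < S → ∀ ζ : P.Z,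
      |S⁻¹ * (∫ τ in (0 : ℝ)..S, q (uz ζ τ, (yz ζ τ : Euc m), (ζ : Euc n)))
        - P.avg q (μ ζ) ζ| ≤ φ S
  flow : P.IsAvgFlow μ z
  unique : ∀ z' : ℝ → P.Z, P.IsAvgFlow μ z' → ∀ t : ℝ, 0 ≤ t → z' t = z t

/-- The family (through the averaged pair `(μ(z(t)), z(t))` it generates) is optimal in the averaged
problem. -/
def IsOptimalACG (P : SPProblem U m n) (μ : P.Z → ProbabilityMeasure (U × P.Y)) (z : ℝ → P.Z) :
    Prop :=
  P.avgCost (fun t => μ (z t)) z = P.avgValue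

/-- The family is `α`-near optimal in the averaged problem. -/
def IsNearOptimalACG (P : SPProblem U m n) (α : ℝ) (μ : P.Z → ProbabilityMeasure (U × P.Y))
    (z : ℝ → P.Z) : Prop :=
  P.avgCost (fun t => μ (z t)) z ≤ P.avgValue + α

/-- `us η ζ` (with trajectory `ys η ζ`) steers the associated system with parameter `ζ` from `η` to
`μ ζ`, uniformly in `η ∈ Y` and `ζ ∈ Z` in the metric `ρ`; the existence of such controls is the
uniform attainability of the family `μ`. -/
def IsUniformSteering (P : SPProblem U m n) (q : ℕ → U × P.Y → ℝ)
    (μ : P.Z → ProbabilityMeasure (U × P.Y))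
    (us : P.Y → P.Z → ℝ → U) (ys : P.Y → P.Z → ℝ → P.Y) : Prop :=
  (∀ η ζ, P.IsAssocAdmissible ζ (us η ζ) (ys η ζ) ∧ ys η ζ 0 = η) ∧
  ∃ φ : ℝ → ℝ, Tendsto φ atTop (𝓝 0) ∧ ∀ S : ℝ, 0 < S → ∀ η ζ,
    rhoDist q (occupOn (fun τ => (us η ζ τ, ys η ζ τ)) S) (μ ζ : Measure (U × P.Y)) ≤ φ S

/-- Weak piecewise Lipschitz continuity in a neighbourhood of `z`: the averages of all Lipschitz
functions, and that of `g`, are piecewise Lipschitz near `z`. -/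
def IsWeaklyPiecewiseLipschitz (P : SPProblem U m n)
    (μ : P.Z → ProbabilityMeasure (U × P.Y)) (z : ℝ → P.Z) : Prop :=
  (∀ q : U × Euc m × Euc n → ℝ, (∃ K : ℝ≥0, LipschitzWith K q) →
    IsPiecewiseLipschitzNear (fun ζ => P.avg q (μ ζ) ζ) z) ∧
  IsPiecewiseLipschitzNear (fun ζ => P.avg P.g (μ ζ) ζ) z

/-- `L > 0` is a Lipschitz constant of `f(u, ·, ·)` on `Y × Z`, for all `u`. -/
def IsLipConstF (P : SPProblem U m n) (L : ℝ) : Prop :=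
  0 < L ∧ ∀ u, ∀ y ∈ P.Y, ∀ y' ∈ P.Y, ∀ z ∈ P.Z, ∀ z' ∈ P.Z,
    ‖P.f (u, y, z) - P.f (u, y', z')‖ ≤ L * (‖y - y'‖ + ‖z - z'‖)

/-- The step `Δ(ε) = ε / (2 L) * log (1 / ε)`. -/
def stepSize (L ε : ℝ) : ℝ := ε / (2 * L) * Real.log (1 / ε)

/-- `u` is the control constructed from the steering controls `us`, and `(y, z)` is the corresponding
solution of the singularly perturbed system: on each interval `[t_l, t_{l+1})`, `t_l = l Δ(ε)`,
`u(t)` is the control that steers the associated system with parameter `z(t_l)` from `y(t_l)`,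
run in the stretched time `(t - t_l) / ε`. -/
def IsConstructed (P : SPProblem U m n) (L : ℝ) (us : P.Y → P.Z → ℝ → U) (ε : ℝ)
    (u : ℝ → U) (y : ℝ → P.Y) (z : ℝ → P.Z) : Prop :=
  P.IsSPTriple ε u (fun t => (y t : Euc m)) (fun t => (z t : Euc n)) ∧
  ∀ l : ℕ, ∀ t ∈ Ico (l * stepSize L ε) ((l + 1) * stepSize L ε),
    u t = us (y (l * stepSize L ε)) (z (l * stepSize L ε)) ((t - l * stepSize L ε) / ε)

/-- For every `T > 0`, the slow trajectories `zε ε` lie, for small `ε`, in a tube around `z` in which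
the average of `g` is piecewise Lipschitz, except for times in small neighbourhoods (shrinking with
`ε`) of the exceptional points of the tube. -/
def StaysInTube (P : SPProblem U m n) (μ : P.Z → ProbabilityMeasure (U × P.Y)) (z : ℝ → P.Z)
    (zε : ℝ → ℝ → P.Z) : Prop :=
  ∀ T : ℝ, 0 < T → ∃ (s : Finset ℝ) (a : ℝ → ℝ),
    PiecewiseLipschitzTube (fun ζ => P.avg P.g (μ ζ) ζ) z T s a ∧
    ∃ δ : ℝ → ℝ, Tendsto δ (𝓝[>] 0) (𝓝 0) ∧
      ∀ᶠ ε in 𝓝[>] (0 : ℝ), 0 < δ ε ∧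
        ∀ t ∈ Icc 0 T, (∀ x ∈ s, t ∉ Ioo (x - δ ε) (x + δ ε)) →
          zε ε t ∈ Metric.ball (z t) (a t)

/-- The controls `u ε`, with the trajectories `(y ε, z ε)`, are asymptotically optimal. -/
def IsAsympOptimal (P : SPProblem U m n) (u : ℝ → ℝ → U) (y : ℝ → ℝ → P.Y) (z : ℝ → ℝ → P.Z) :
    Prop :=
  ∃ ℓ : ℝ,
    Tendsto (fun ε => P.cost (u ε) (fun t => (y ε t : Euc m)) (fun t => (z ε t : Euc n)))
      (𝓝[>] 0) (𝓝 ℓ) ∧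
    Tendsto P.value (𝓝[>] 0) (𝓝 ℓ)

/-- The controls `u ε`, with the trajectories `(y ε, z ε)`, are asymptotically `α`-near optimal. -/
def IsAsympNearOptimal (P : SPProblem U m n) (α : ℝ) (u : ℝ → ℝ → U) (y : ℝ → ℝ → P.Y)
    (z : ℝ → ℝ → P.Z) : Prop :=
  ∃ ℓ : ℝ,
    Tendsto (fun ε => P.cost (u ε) (fun t => (y ε t : Euc m)) (fun t => (z ε t : Euc n)))
      (𝓝[>] 0) (𝓝 ℓ) ∧
    ℓ ≤ liminf P.value (𝓝[>] 0) + α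

end SPProblem

end

/-!
On a step of length `Δ(ε) = ε / (2 L) * log (1 / ε)` the stretched time runs over an interval of
length `log (1 / ε) / (2 L)`. This tends to infinity, so the steered pair nearly realizes its
occupational measure `μ(· | z_ε(t_l))`, yet it is so short that by Grönwall's inequality the fast
trajectory stays within a factor `ε ^ (-1 / 2)` times the `O(Δ(ε))` drift of the slow variable of
the steered one. Hence integrals along `(u_ε, y_ε, z_ε)` are asymptotically integrals of the
averages `q̃_μ(z_ε(t_l))`. For the coordinates of `g`, the piecewise Lipschitz continuity of `g̃_μ`
in the tube and Grönwall's inequality give `z_ε → z`; for `G`, integration by parts against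
`exp (-C t)` and dominated convergence give convergence of the costs to that of `(μ(· | z(t)), z)`.

For the lower bound on the optimal values when `C Ṽ* = G̃*`, the discounted occupational measures of
the singularly perturbed solutions form a tight family. In a weak limit the test functions
`ψ(z) φ(y)` show that the fibres of the disintegration over `z` lie in `W(z)`, and functions `ψ(z)`
alone give the constraint of the averaged linear program. So `liminf C V*(ε) ≥ G̃*`.
-/

section RealAnalysis

theorem le_mul_exp_of_le_add_mul_integral {v : ℝ → ℝ} {E K T : ℝ} (hK : 0 ≤ K)
    (hv : ContinuousOn v (Icc 0 T))
    (h : ∀ t ∈ Icc 0 T, v t ≤ E + K * ∫ s in (0 : ℝ)..t, v s) :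
    ∀ t ∈ Icc 0 T, v t ≤ E * Real.exp (K * t) := by
  intro t ht
  have hint : ∀ s ∈ Icc 0 T, IntervalIntegrable v volume 0 s := fun s hs =>
    (hv.mono (Icc_subset_Icc_right hs.2)).intervalIntegrable_of_Icc hs.1
  have hcont : ContinuousOn (fun s => ∫ r in (0 : ℝ)..s, v r) (Icc 0 T) := by
    have hT : (0 : ℝ) ≤ T := ht.1.trans ht.2
    have := intervalIntegral.continuousOn_primitive_interval' (hint T ⟨hT, le_rfl⟩) left_mem_uIcc
    rwa [uIcc_of_le hT] at this
  have hderiv : ∀ s ∈ Ico 0 T,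
      HasDerivWithinAt (fun r => ∫ x in (0 : ℝ)..r, v x) (v s) (Ici s) s := by
    intro s hs
    have hnhds : Icc 0 T ∈ 𝓝[>] s := mem_of_superset (Icc_mem_nhdsGT_of_mem hs) subset_rfl
    exact intervalIntegral.integral_hasDerivWithinAt_right (hint s ⟨hs.1, hs.2.le⟩)
      ⟨Icc 0 T, hnhds, hv.aestronglyMeasurable measurableSet_Icc⟩
      ((hv s ⟨hs.1, hs.2.le⟩).mono_of_mem_nhdsWithin hnhds)
  have hprim := le_gronwallBound_of_liminf_deriv_right_le (δ := 0) (K := K) (ε := E) hcont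
    (fun s hs _ hr => (hderiv s hs).liminf_right_slope_le hr) (by simp)
    (fun s hs => by linarith [h s ⟨hs.1, hs.2.le⟩]) t ht
  refine (h t ht).trans ?_
  rcases hK.eq_or_lt with rfl | hKpos
  · simp
  simp only [gronwallBound_of_K_ne_0 hKpos.ne', zero_mul, zero_add, sub_zero] at hprim
  calc E + K * ∫ s in (0 : ℝ)..t, v s
      ≤ E + K * (E / K * (Real.exp (K * t) - 1)) := by gcongr
    _ = E * Real.exp (K * t) := by field_simp; ring

theorem intervalIntegrable_of_forall_norm_le {E : Type*} [NormedAddCommGroup E] {F : ℝ → E}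
    {B : ℝ} (hm : AEStronglyMeasurable F (volume.restrict (Ici 0)))
    (hB : ∀ t, 0 ≤ t → ‖F t‖ ≤ B) {a b : ℝ} (ha : 0 ≤ a) (hb : 0 ≤ b) :
    IntervalIntegrable F volume a b := by
  have hsub : uIoc a b ⊆ Ici 0 := fun t ht => (le_min ha hb).trans ht.1.le
  refine (intervalIntegrable_const (c := B)).mono_fun
    (hm.mono_measure (Measure.restrict_mono hsub le_rfl)) ?_
  filter_upwards [ae_restrict_mem measurableSet_uIoc] with t ht
  exact (hB t (hsub ht)).trans (le_abs_self B)

theorem ae_hasDerivAt_integral_of_pos {E : Type*} [NormedAddCommGroup E] [NormedSpace ℝ E]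
    [CompleteSpace E] {v : ℝ → E} (hv : ∀ t : ℝ, 0 ≤ t → IntervalIntegrable v volume 0 t) :
    ∀ᵐ t, 0 < t → HasDerivAt (fun s => ∫ r in (0 : ℝ)..s, v r) (v t) t := by
  have hnat : ∀ N : ℕ, ∀ᵐ t, t ∈ uIcc (0 : ℝ) N → ∀ c ∈ uIcc (0 : ℝ) N,
      HasDerivAt (fun s => ∫ r in c..s, v r) (v t) t := fun N =>
    (hv N (Nat.cast_nonneg N)).ae_hasDerivAt_integral
  filter_upwards [ae_all_iff.2 hnat] with t ht ht0
  obtain ⟨N, hN⟩ := exists_nat_ge t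
  exact ht N (by rw [uIcc_of_le (Nat.cast_nonneg N)]; exact ⟨ht0.le, hN⟩) 0 left_mem_uIcc

theorem tendsto_integral_max_zero_of_eventually_nonpos {ι : Type*} {l : Filter ι}
    [l.IsCountablyGenerated] {h : ι → ℝ → ℝ} {B T : ℝ} (hT : 0 ≤ T)
    (hint : ∀ᶠ i in l, IntervalIntegrable (h i) volume 0 T)
    (hB : ∀ᶠ i in l, ∀ t ∈ Icc 0 T, h i t ≤ B)
    (hnonpos : ∀ᵐ t ∂(volume.restrict (Icc 0 T)), ∀ᶠ i in l, h i t ≤ 0) :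
    Tendsto (fun i => ∫ t in (0 : ℝ)..T, max 0 (h i t)) l (𝓝 0) := by
  have hdom : Tendsto (fun i => ∫ t in (0 : ℝ)..T, max 0 (h i t)) l
      (𝓝 (∫ _ in (0 : ℝ)..T, (0 : ℝ))) := by
    refine intervalIntegral.tendsto_integral_filter_of_dominated_convergence (fun _ => max 0 B)
      ?_ ?_ intervalIntegrable_const ?_
    · filter_upwards [hint] with i hi
      rw [uIoc_of_le hT]
      exact aestronglyMeasurable_const.sup hi.1.aestronglyMeasurable
    · filter_upwards [hB] with i hi
      refine Eventually.of_forall fun t ht => ?_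
      rw [uIoc_of_le hT] at ht
      rw [Real.norm_of_nonneg (le_max_left _ _)]
      exact max_le_max le_rfl (hi t (Ioc_subset_Icc_self ht))
    · rw [ae_restrict_iff' measurableSet_Icc] at hnonpos
      filter_upwards [hnonpos] with t ht htT
      rw [uIoc_of_le hT] at htT
      refine tendsto_const_nhds.congr' ?_
      filter_upwards [ht (Ioc_subset_Icc_self htT)] with i hi
      exact (max_eq_left hi).symm
  simpa using hdom

theorem le_mul_exp_of_le_add_integral_of_excess {w F : ℝ → ℝ} {K κ T : ℝ} (hK : 0 ≤ K)
    (hκ : 0 ≤ κ) (hw : ContinuousOn w (Icc 0 T)) (hF : IntervalIntegrable F volume 0 T)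
    (hwF : ∀ t ∈ Icc 0 T, w t ≤ κ + ∫ s in (0 : ℝ)..t, F s)
    (hexcess : ∫ s in (0 : ℝ)..T, max 0 (F s - (K * w s + κ)) ≤ κ) :
    ∀ t ∈ Icc 0 T, w t ≤ κ * (2 + T) * Real.exp (K * T) := by
  intro t₁ ht₁
  have hT : (0 : ℝ) ≤ T := ht₁.1.trans ht₁.2
  have hKw : IntervalIntegrable (fun s => K * w s) volume 0 T :=
    (hw.intervalIntegrable_of_Icc hT).const_mul K
  have hdiff := hF.sub (hKw.add (intervalIntegrable_const (c := κ)))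
  have hexcess_int : IntervalIntegrable (fun s => max 0 (F s - (K * w s + κ))) volume 0 T :=
    ⟨(integrable_zero _ _ _).sup hdiff.1, (integrable_zero _ _ _).sup hdiff.2⟩
  have hgron := le_mul_exp_of_le_add_mul_integral (E := κ * (2 + T)) hK hw fun t ht => ?_
  · calc w t₁ ≤ κ * (2 + T) * Real.exp (K * t₁) := hgron t₁ ht₁
      _ ≤ κ * (2 + T) * Real.exp (K * T) := by have := ht₁.2; gcongr
  have hsub : uIcc 0 t ⊆ uIcc 0 T := by
    rw [uIcc_of_le ht.1, uIcc_of_le hT]; exact Icc_subset_Icc_right ht.2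
  have hKw_t := hKw.mono_set hsub
  have hexcess_t := hexcess_int.mono_set hsub
  have hexcess_le : ∫ s in (0 : ℝ)..t, max 0 (F s - (K * w s + κ)) ≤ κ :=
    (intervalIntegral.integral_mono_interval le_rfl ht.1 ht.2
      (Eventually.of_forall fun s => le_max_left _ _) hexcess_int).trans hexcess
  have hF_le : ∫ s in (0 : ℝ)..t, F s
      ≤ ∫ s in (0 : ℝ)..t, (K * w s + κ + max 0 (F s - (K * w s + κ))) :=
    intervalIntegral.integral_mono_on ht.1 (hF.mono_set hsub)
      ((hKw_t.add intervalIntegrable_const).add hexcess_t)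
      fun s _ => by linarith [le_max_right 0 (F s - (K * w s + κ))]
  rw [intervalIntegral.integral_add (hKw_t.add intervalIntegrable_const) hexcess_t,
    intervalIntegral.integral_add hKw_t intervalIntegrable_const,
    intervalIntegral.integral_const_mul, intervalIntegral.integral_const, smul_eq_mul,
    sub_zero] at hF_le
  have hκt : t * κ ≤ T * κ := by have := ht.2; gcongr
  linarith [hwF t ht]

/-- The integral of the excess of `F` over `K w + κ` tends to zero by dominated convergence, so the
excess only perturbs the constant in Grönwall's inequality. -/
theorem eventually_forall_le_of_approx_gronwall {ι : Type*} {l : Filter ι}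
    [l.IsCountablyGenerated] {w F : ι → ℝ → ℝ} {K B T : ℝ} (hK : 0 ≤ K) (hT : 0 ≤ T)
    (hw : ∀ᶠ i in l, ContinuousOn (w i) (Icc 0 T)) (hw0 : ∀ᶠ i in l, ∀ t ∈ Icc 0 T, 0 ≤ w i t)
    (hF : ∀ᶠ i in l, IntervalIntegrable (F i) volume 0 T)
    (hFB : ∀ᶠ i in l, ∀ t ∈ Icc 0 T, F i t ≤ B)
    (hwF : ∀ η > 0, ∀ᶠ i in l, ∀ t ∈ Icc 0 T, w i t ≤ η + ∫ s in (0 : ℝ)..t, F i s)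
    (hFw : ∀ᵐ t ∂(volume.restrict (Icc 0 T)), ∀ η > 0, ∀ᶠ i in l, F i t ≤ K * w i t + η)
    {η : ℝ} (hη : 0 < η) : ∀ᶠ i in l, ∀ t ∈ Icc 0 T, w i t ≤ η := by
  obtain ⟨κ, hκ, hκη⟩ : ∃ κ > 0, κ * (2 + T) * Real.exp (K * T) = η :=
    ⟨η / ((2 + T) * Real.exp (K * T)), by positivity, by field_simp⟩
  have hexcess : Tendsto (fun i => ∫ t in (0 : ℝ)..T, max 0 (F i t - (K * w i t + κ))) l
      (𝓝 0) := by
    refine tendsto_integral_max_zero_of_eventually_nonpos (B := B) hT ?_ ?_ ?_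
    · filter_upwards [hw, hF] with i hwi hFi
      exact hFi.sub (((hwi.intervalIntegrable_of_Icc hT).const_mul K).add intervalIntegrable_const)
    · filter_upwards [hw0, hFB] with i hwi hFi t ht
      linarith [mul_nonneg hK (hwi t ht), hFi t ht]
    · filter_upwards [hFw] with t ht
      exact (ht κ hκ).mono fun i hi => sub_nonpos.2 hi
  filter_upwards [hw, hF, hwF κ hκ, hexcess.eventually_le_const hκ] with i hwi hFi hwFi hei
  rw [← hκη]
  exact le_mul_exp_of_le_add_integral_of_excess hK hκ.le hwi hFi hwFi hei

end RealAnalysis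

namespace HasVelocity

variable {k : ℕ} {x v : ℝ → Euc k}

theorem intervalIntegrable (h : HasVelocity x v) {a b : ℝ} (ha : 0 ≤ a) (hb : 0 ≤ b) :
    IntervalIntegrable v volume a b :=
  (h a ha).1.symm.trans (h b hb).1

theorem sub_eq_integral (h : HasVelocity x v) {a b : ℝ} (ha : 0 ≤ a) (hb : 0 ≤ b) :
    x b - x a = ∫ t in a..b, v t := by
  rw [(h a ha).2, (h b hb).2, ← intervalIntegral.integral_interval_sub_left (h b hb).1 (h a ha).1]
  abel

theorem norm_sub_le (h : HasVelocity x v) {M : ℝ} (hM : ∀ t, 0 ≤ t → ‖v t‖ ≤ M) {a b : ℝ}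
    (ha : 0 ≤ a) (hb : 0 ≤ b) : ‖x b - x a‖ ≤ M * |b - a| := by
  rw [h.sub_eq_integral ha hb]
  exact intervalIntegral.norm_integral_le_of_norm_le_const fun t ht =>
    hM t ((le_min ha hb).trans ht.1.le)

theorem lipschitzOnWith (h : HasVelocity x v) {M : ℝ≥0} (hM : ∀ t, 0 ≤ t → ‖v t‖ ≤ M) :
    LipschitzOnWith M x (Ici 0) :=
  LipschitzOnWith.of_dist_le_mul fun a ha b hb => by
    rw [dist_eq_norm, Real.dist_eq]; exact h.norm_sub_le hM hb ha

theorem continuousOn (h : HasVelocity x v) : ContinuousOn x (Ici 0) := by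
  intro t ht
  have ht1 : (0 : ℝ) ≤ t + 1 := add_nonneg ht zero_le_one
  have hprim : ContinuousOn (fun s => x 0 + ∫ r in (0 : ℝ)..s, v r) (Icc 0 (t + 1)) := by
    have := intervalIntegral.continuousOn_primitive_interval' (h (t + 1) ht1).1 left_mem_uIcc
    rw [uIcc_of_le ht1] at this
    exact continuousOn_const.add this
  have hx : ContinuousOn x (Icc 0 (t + 1)) := hprim.congr fun s hs => (h s hs.1).2
  refine (hx t ⟨ht, (lt_add_one t).le⟩).mono_of_mem_nhdsWithin ?_
  exact inter_mem self_mem_nhdsWithin (mem_nhdsWithin_of_mem_nhds (Iic_mem_nhds (lt_add_one t)))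

theorem ae_hasDerivAt (h : HasVelocity x v) : ∀ᵐ t, 0 < t → HasDerivAt x (v t) t := by
  filter_upwards [ae_hasDerivAt_integral_of_pos fun t ht => (h t ht).1] with t ht ht0
  refine ((ht ht0).const_add (x 0)).congr_of_eventuallyEq ?_
  filter_upwards [Ioi_mem_nhds ht0] with s hs
  exact (h s (le_of_lt hs)).2

theorem comp_add_mul (h : HasVelocity x v) {a c : ℝ} (ha : 0 ≤ a) (hc : 0 < c) :
    HasVelocity (fun t => x (a + c * t)) (fun t => c • v (a + c * t)) := by
  intro t ht
  have hat : 0 ≤ a + c * t := by positivity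
  constructor
  · have hcomp : IntervalIntegrable (fun t => v (a + c * t)) volume 0 t := by
      simpa [mul_div_cancel_left₀ _ hc.ne'] using
        ((h.intervalIntegrable ha hat).comp_add_left a).comp_mul_left (c := c)
    exact hcomp.smul c
  · rw [intervalIntegral.integral_smul, intervalIntegral.smul_integral_comp_add_mul, mul_zero,
      add_zero, ← h.sub_eq_integral ha hat]
    simp

theorem norm_sub_le_integral {x' v' : ℝ → Euc k} (h : HasVelocity x v) (h' : HasVelocity x' v')
    (h0 : x 0 = x' 0) {t : ℝ} (ht : 0 ≤ t) {b : ℝ → ℝ} (hb : IntervalIntegrable b volume 0 t)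
    (hvb : ∀ s ∈ Ioo 0 t, ‖v s - v' s‖ ≤ b s) : ‖x t - x' t‖ ≤ ∫ s in (0 : ℝ)..t, b s := by
  rw [(h t ht).2, (h' t ht).2, h0, add_sub_add_left_eq_sub,
    ← intervalIntegral.integral_sub (h t ht).1 (h' t ht).1]
  refine intervalIntegral.norm_integral_le_of_norm_le ht ?_ hb
  filter_upwards [compl_mem_ae_iff.2 (measure_singleton t)] with s hst hs
  exact hvb s ⟨hs.1, lt_of_le_of_ne hs.2 hst⟩

theorem norm_sub_le_of_norm_velocity_sub_le {x' v' : ℝ → Euc k} (h : HasVelocity x v)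
    (h' : HasVelocity x' v') (h0 : x 0 = x' 0) {L r S : ℝ} (hL : 0 ≤ L) (hr : 0 ≤ r)
    (hv : ∀ s ∈ Ioo 0 S, ‖v s - v' s‖ ≤ L * (‖x s - x' s‖ + r)) :
    ∀ s ∈ Icc 0 S, ‖x s - x' s‖ ≤ L * r * S * Real.exp (L * S) := by
  intro s₁ hs₁
  have hcont : ContinuousOn (fun s => ‖x s - x' s‖) (Icc 0 S) :=
    (h.continuousOn.sub h'.continuousOn).norm.mono Icc_subset_Ici_self
  have hgron := le_mul_exp_of_le_add_mul_integral (E := L * r * S) hL hcont fun s hs => ?_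
  · refine (hgron s₁ hs₁).trans ?_
    have hS := hs₁.1.trans hs₁.2
    have := hs₁.2
    gcongr
  have hint : IntervalIntegrable (fun σ => ‖x σ - x' σ‖) volume 0 s :=
    (hcont.mono (Icc_subset_Icc_right hs.2)).intervalIntegrable_of_Icc hs.1
  have hle := h.norm_sub_le_integral h' h0 hs.1
    ((hint.add (intervalIntegrable_const (c := r))).const_mul L)
    fun σ hσ => hv σ ⟨hσ.1, hσ.2.trans_le hs.2⟩
  rw [intervalIntegral.integral_const_mul, intervalIntegral.integral_add hint
    intervalIntegrable_const, intervalIntegral.integral_const, smul_eq_mul, sub_zero] at hle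
  have hLr : L * (s * r) ≤ L * r * S := by
    have := hs.2
    rw [mul_assoc, mul_comm s r]
    gcongr
  linarith

end HasVelocity

section Discount

variable {C : ℝ}

theorem integrableOn_exp_neg_mul (hC : 0 < C) :
    IntegrableOn (fun t => Real.exp (-(C * t))) (Ioi 0) := by
  simpa [neg_mul] using integrableOn_exp_mul_Ioi (neg_lt_zero.2 hC) 0

theorem integral_exp_neg_mul (hC : 0 < C) : ∫ t in Ioi (0 : ℝ), Real.exp (-(C * t)) = C⁻¹ := by
  simpa [neg_mul, neg_div, div_neg] using integral_exp_mul_Ioi (neg_lt_zero.2 hC) 0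

theorem integrableOn_mul_exp_neg_mul (hC : 0 < C) :
    IntegrableOn (fun t : ℝ => t * Real.exp (-(C * t))) (Ioi 0) := by
  simpa [neg_mul] using
    integrableOn_rpow_mul_exp_neg_mul_rpow (s := 1) (p := 1) (by norm_num) one_pos hC

theorem integral_mul_exp_neg_mul (hC : 0 < C) :
    ∫ t in Ioi (0 : ℝ), t * Real.exp (-(C * t)) = (C ^ 2)⁻¹ := by
  simpa [show (2 : ℝ) - 1 = 1 by norm_num] using
    Real.integral_rpow_mul_exp_neg_mul_Ioi (a := 2) two_pos hC

theorem integrableOn_exp_neg_mul_of_bounded (hC : 0 < C) {B : ℝ} {h : ℝ → ℝ}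
    (hm : AEStronglyMeasurable h (volume.restrict (Ioi 0))) (hB : ∀ t, 0 < t → |h t| ≤ B) :
    IntegrableOn (fun t => Real.exp (-(C * t)) * h t) (Ioi 0) := by
  refine (integrableOn_exp_neg_mul hC).mul_bdd (c := B) hm ?_
  filter_upwards [ae_restrict_mem measurableSet_Ioi] with t ht using hB t ht

section LinearGrowth

variable {F : ℝ → ℝ} {a b : ℝ}

theorem abs_exp_neg_mul_mul_le_of_linear_growth (hF : ∀ t, 0 ≤ t → |F t| ≤ a + b * t) {t : ℝ}
    (ht : 0 ≤ t) : |Real.exp (-(C * t)) * F t|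
      ≤ a * Real.exp (-(C * t)) + b * (t * Real.exp (-(C * t))) := by
  rw [abs_mul, abs_of_pos (Real.exp_pos _)]
  linarith [mul_le_mul_of_nonneg_left (hF t ht) (Real.exp_pos (-(C * t))).le]

theorem integrableOn_linear_mul_exp_neg_mul (hC : 0 < C) :
    IntegrableOn (fun t => a * Real.exp (-(C * t)) + b * (t * Real.exp (-(C * t)))) (Ioi 0) :=
  ((integrableOn_exp_neg_mul hC).const_mul a).add ((integrableOn_mul_exp_neg_mul hC).const_mul b)

theorem tendsto_exp_neg_mul_mul_of_linear_growth (hC : 0 < C)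
    (hF : ∀ t, 0 ≤ t → |F t| ≤ a + b * t) :
    Tendsto (fun t => Real.exp (-(C * t)) * F t) atTop (𝓝 0) := by
  have hexp : Tendsto (fun t : ℝ => Real.exp (-(C * t))) atTop (𝓝 0) :=
    Real.tendsto_exp_neg_atTop_nhds_zero.comp (tendsto_id.const_mul_atTop hC)
  have hmul : Tendsto (fun t : ℝ => t * Real.exp (-(C * t))) atTop (𝓝 0) := by
    have hscaled : Tendsto (fun t : ℝ => C⁻¹ * (C * t * Real.exp (-(C * t)))) atTop (𝓝 0) := by
      simpa using ((Real.tendsto_pow_mul_exp_neg_atTop_nhds_zero 1).comp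
        (tendsto_id.const_mul_atTop hC)).const_mul C⁻¹
    refine hscaled.congr fun t => ?_
    field_simp
  refine squeeze_zero_norm' ?_
    (by simpa using (hexp.const_mul a).add (hmul.const_mul b))
  filter_upwards [eventually_ge_atTop 0] with t ht
  exact abs_exp_neg_mul_mul_le_of_linear_growth hF ht

theorem integrableOn_exp_neg_mul_of_linear_growth (hC : 0 < C)
    (hm : AEStronglyMeasurable F (volume.restrict (Ioi 0)))
    (hF : ∀ t, 0 ≤ t → |F t| ≤ a + b * t) :
    IntegrableOn (fun t => Real.exp (-(C * t)) * F t) (Ioi 0) := by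
  have hexp : Continuous fun t : ℝ => Real.exp (-(C * t)) := by fun_prop
  refine (integrableOn_linear_mul_exp_neg_mul (a := a) (b := b) hC).mono'
    (hexp.aestronglyMeasurable.mul hm) ?_
  filter_upwards [ae_restrict_mem measurableSet_Ioi] with t ht
  exact abs_exp_neg_mul_mul_le_of_linear_growth hF (le_of_lt ht)

theorem abs_integral_exp_neg_mul_le_of_linear_growth (hC : 0 < C)
    (hF : ∀ t, 0 ≤ t → |F t| ≤ a + b * t) :
    |∫ t in Ioi (0 : ℝ), Real.exp (-(C * t)) * F t| ≤ a * C⁻¹ + b * (C ^ 2)⁻¹ := by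
  rw [← integral_exp_neg_mul hC, ← integral_mul_exp_neg_mul hC, ← integral_const_mul,
    ← integral_const_mul, ← integral_add ((integrableOn_exp_neg_mul hC).const_mul a)
      ((integrableOn_mul_exp_neg_mul hC).const_mul b)]
  refine norm_integral_le_of_norm_le (f := fun t => Real.exp (-(C * t)) * F t)
    (integrableOn_linear_mul_exp_neg_mul hC) ?_
  filter_upwards [ae_restrict_mem measurableSet_Ioi] with t ht
  exact abs_exp_neg_mul_mul_le_of_linear_growth hF (le_of_lt ht)

end LinearGrowth

section Laplace

variable {F h : ℝ → ℝ} {K : ℝ≥0}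

theorem abs_le_abs_zero_add_mul_of_lipschitzOnWith (hF : LipschitzOnWith K F (Ici 0)) {t : ℝ}
    (ht : 0 ≤ t) : |F t| ≤ |F 0| + K * t := by
  have hdist := hF.dist_le_mul t ht 0 self_mem_Ici
  rw [Real.dist_eq, Real.dist_eq, sub_zero, abs_of_nonneg ht] at hdist
  linarith [abs_sub_abs_le_abs_sub (F t) (F 0)]

theorem integral_exp_neg_mul_deriv_sub (C : ℝ) (hF : LipschitzOnWith K F (Ici 0))
    (hd : ∀ᵐ t, 0 < t → HasDerivAt F (h t) t) {T : ℝ} (hT : 0 ≤ T) :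
    ∫ t in (0 : ℝ)..T, (Real.exp (-(C * t)) * h t - C * (Real.exp (-(C * t)) * F t))
      = Real.exp (-(C * T)) * F T - F 0 := by
  have hac : AbsolutelyContinuousOnInterval (fun t => Real.exp (-(C * t)) * F t) 0 T := by
    refine AbsolutelyContinuousOnInterval.mul
      (ContDiffOn.absolutelyContinuousOnInterval (by fun_prop))
      (hF.mono ?_).absolutelyContinuousOnInterval
    rw [uIcc_of_le hT]
    exact Icc_subset_Ici_self
  have hFTC := hac.integral_deriv_eq_sub
  simp only [mul_zero, neg_zero, Real.exp_zero, one_mul] at hFTC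
  rw [← hFTC]
  refine intervalIntegral.integral_congr_ae ?_
  filter_upwards [hd] with t ht htT
  rw [uIoc_of_le hT] at htT
  have hexp : HasDerivAt (fun t => Real.exp (-(C * t))) (Real.exp (-(C * t)) * -(C * 1)) t :=
    ((hasDerivAt_id t).const_mul C).neg.exp
  have hprod : HasDerivAt (fun t => Real.exp (-(C * t)) * F t) _ t := hexp.mul (ht htT.1)
  rw [hprod.deriv]
  ring

theorem integral_exp_neg_mul_deriv (hC : 0 < C) (hF : LipschitzOnWith K F (Ici 0))
    (hd : ∀ᵐ t, 0 < t → HasDerivAt F (h t) t)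
    (hh : IntegrableOn (fun t => Real.exp (-(C * t)) * h t) (Ioi 0)) :
    ∫ t in Ioi (0 : ℝ), Real.exp (-(C * t)) * h t
      = -F 0 + C * ∫ t in Ioi (0 : ℝ), Real.exp (-(C * t)) * F t := by
  have hgrowth := fun t (ht : 0 ≤ t) => abs_le_abs_zero_add_mul_of_lipschitzOnWith hF ht
  have hFint : IntegrableOn (fun t => C * (Real.exp (-(C * t)) * F t)) (Ioi 0) :=
    (integrableOn_exp_neg_mul_of_linear_growth hC
      ((hF.continuousOn.mono Ioi_subset_Ici_self).aestronglyMeasurable measurableSet_Ioi)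
      hgrowth).const_mul C
  have hlim := intervalIntegral_tendsto_integral_Ioi 0 (hh.sub hFint) tendsto_id
  have hparts : Tendsto (fun T => Real.exp (-(C * T)) * F T - F 0) atTop (𝓝 (0 - F 0)) :=
    (tendsto_exp_neg_mul_mul_of_linear_growth hC hgrowth).sub_const (F 0)
  have heq := tendsto_nhds_unique hlim (hparts.congr' ?_)
  · rw [integral_sub' hh hFint, integral_const_mul] at heq
    linarith
  filter_upwards [eventually_ge_atTop 0] with T hT
  exact (integral_exp_neg_mul_deriv_sub C hF hd hT).symm

end Laplace

theorem abs_integral_exp_neg_mul_le_of_forall_abs_primitive_le (hC : 0 < C) {h : ℝ → ℝ} {B η : ℝ}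
    (hm : AEStronglyMeasurable h (volume.restrict (Ici 0))) (hB : ∀ t, 0 ≤ t → |h t| ≤ B)
    (hη : ∀ t, 0 ≤ t → |∫ s in (0 : ℝ)..t, h s| ≤ η * (t + 1)) :
    |∫ t in Ioi (0 : ℝ), Real.exp (-(C * t)) * h t| ≤ η * (1 + C⁻¹) := by
  set F : ℝ → ℝ := fun t => ∫ s in (0 : ℝ)..t, h s with hF
  have hint {a b : ℝ} (ha : 0 ≤ a) (hb : 0 ≤ b) : IntervalIntegrable h volume a b :=
    intervalIntegrable_of_forall_norm_le hm hB ha hb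
  have hlip : LipschitzOnWith B.toNNReal F (Ici 0) :=
    LipschitzOnWith.of_dist_le_mul fun a ha b hb => by
      rw [Real.dist_eq, intervalIntegral.integral_interval_sub_left (hint le_rfl ha)
        (hint le_rfl hb), Real.dist_eq]
      exact intervalIntegral.norm_integral_le_of_norm_le_const (f := h) fun t ht =>
        (hB t ((le_min hb ha).trans ht.1.le)).trans (Real.le_coe_toNNReal B)
  have hh : IntegrableOn (fun t => Real.exp (-(C * t)) * h t) (Ioi 0) :=
    integrableOn_exp_neg_mul_of_bounded hC
      (hm.mono_measure (Measure.restrict_mono Ioi_subset_Ici_self le_rfl)) fun t ht => hB t ht.le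
  rw [integral_exp_neg_mul_deriv hC hlip
    (ae_hasDerivAt_integral_of_pos fun t ht => hint le_rfl ht) hh]
  simp only [hF, intervalIntegral.integral_same, neg_zero, zero_add]
  rw [abs_mul, abs_of_pos hC]
  calc C * |∫ t in Ioi (0 : ℝ), Real.exp (-(C * t)) * F t|
      ≤ C * (η * C⁻¹ + η * (C ^ 2)⁻¹) := by
        gcongr
        exact abs_integral_exp_neg_mul_le_of_linear_growth hC fun t ht => by linarith [hη t ht]
    _ = η * (1 + C⁻¹) := by field_simp

end Discount

section LipschitzApproximation

variable {X : Type*} [PseudoMetricSpace X] {s : Set X} {q : X → ℝ} {η : ℝ}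

theorem exists_forall_abs_sub_le_add_mul_dist (hs : IsCompact s) (hq : ContinuousOn q s)
    (hη : 0 < η) : ∃ K : ℝ≥0, ∀ x ∈ s, ∀ y ∈ s, |q x - q y| ≤ η + K * dist x y := by
  obtain ⟨B, hB⟩ := hs.exists_bound_of_continuousOn hq
  obtain ⟨δ, hδ, hclose⟩ := Metric.uniformContinuousOn_iff.1
    (hs.uniformContinuousOn_of_continuous hq) η hη
  refine ⟨(2 * B / δ).toNNReal, fun x hx y hy => ?_⟩
  have hK := Real.le_coe_toNNReal (2 * B / δ)
  by_cases hxy : dist x y < δ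
  · have := (Real.dist_eq _ _ ▸ hclose x hx y hy hxy).le
    have : 0 ≤ ((2 * B / δ).toNNReal : ℝ) * dist x y := by positivity
    linarith
  · calc |q x - q y| ≤ B + B := (abs_sub _ _).trans (add_le_add (hB x hx) (hB y hy))
      _ = 2 * B / δ * δ := by field_simp; ring
      _ ≤ (2 * B / δ).toNNReal * dist x y := by have := not_lt.1 hxy; gcongr
      _ ≤ η + (2 * B / δ).toNNReal * dist x y := by linarith

theorem exists_lipschitzWith_of_forall_abs_sub_le_add_mul_dist {K : ℝ≥0}
    (hq : ∀ x ∈ s, ∀ y ∈ s, |q x - q y| ≤ η + K * dist x y) :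
    ∃ p : X → ℝ, LipschitzWith K p ∧ ∀ x ∈ s, |p x - q x| ≤ η := by
  rcases s.eq_empty_or_nonempty with rfl | ⟨x₀, hx₀⟩
  · exact ⟨fun _ => 0, LipschitzWith.const' 0, by simp⟩
  have : Nonempty s := ⟨x₀, hx₀⟩
  have hbdd : ∀ x : X, BddBelow (range fun y : s => q y + K * dist x (y : X)) := by
    refine fun x => ⟨q x₀ - η - K * dist x x₀, ?_⟩
    rintro _ ⟨y, rfl⟩
    have htri := mul_le_mul_of_nonneg_left (dist_triangle_left x₀ (y : X) x) K.coe_nonneg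
    have := (abs_le.1 (hq x₀ hx₀ y y.2)).2
    dsimp only
    linarith
  refine ⟨fun x => ⨅ y : s, q y + K * dist x y, LipschitzWith.of_le_add_mul K fun x x' => ?_,
    fun x hx => abs_le.2 ⟨?_, ?_⟩⟩
  · rw [← sub_le_iff_le_add]
    refine le_ciInf fun y => sub_le_iff_le_add.2 ((ciInf_le (hbdd x) y).trans ?_)
    linarith [mul_le_mul_of_nonneg_left (dist_triangle x x' y) K.coe_nonneg]
  · rw [le_sub_iff_add_le, neg_add_eq_sub]
    exact le_ciInf fun y => by linarith [(abs_le.1 (hq x hx y y.2)).2]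
  · have hinf := ciInf_le (hbdd x) ⟨x, hx⟩
    have hη : 0 ≤ η := by simpa using hq x hx x hx
    simp only [dist_self, mul_zero, add_zero] at hinf
    linarith

theorem exists_lipschitzWith_abs_sub_le_of_isCompact (hs : IsCompact s) (hq : ContinuousOn q s)
    (hη : 0 < η) :
    ∃ (K : ℝ≥0) (p : X → ℝ), LipschitzWith K p ∧ ∀ x ∈ s, |p x - q x| ≤ η :=
  let ⟨K, hK⟩ := exists_forall_abs_sub_le_add_mul_dist hs hq hη
  ⟨K, exists_lipschitzWith_of_forall_abs_sub_le_add_mul_dist hK⟩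

end LipschitzApproximation

section Occupational

variable {W : Type*} [MeasurableSpace W]

theorem norm_integral_sub_integral_le_of_forall_norm_sub_le {E : Type*} [NormedAddCommGroup E]
    [NormedSpace ℝ E] {ν : Measure W} [IsProbabilityMeasure ν] {h h' : W → E}
    (hi : Integrable h ν) (hi' : Integrable h' ν) {η : ℝ} (hη : ∀ w, ‖h w - h' w‖ ≤ η) :
    ‖(∫ w, h w ∂ν) - ∫ w, h' w ∂ν‖ ≤ η := by
  rw [← integral_sub hi hi']
  simpa using norm_integral_le_of_norm_le_const (μ := ν) (Eventually.of_forall hη)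

theorem summable_rhoDist_term {q : ℕ → W → ℝ} (hq : ∀ l w, |q l w| ≤ 1) (γ γ' : Measure W)
    [IsProbabilityMeasure γ] [IsProbabilityMeasure γ'] :
    Summable fun l : ℕ => (1 / 2 : ℝ) ^ (l + 1) * |(∫ w, q l w ∂γ) - ∫ w, q l w ∂γ'| := by
  have hbound (ν : Measure W) [IsProbabilityMeasure ν] (l : ℕ) : |∫ w, q l w ∂ν| ≤ 1 := by
    simpa using norm_integral_le_of_norm_le_const (μ := ν) (f := q l) (Eventually.of_forall (hq l))
  refine Summable.of_nonneg_of_le (fun l => by positivity) (fun l => ?_)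
    (summable_geometric_two.mul_right 1)
  rw [pow_succ, mul_assoc]
  gcongr
  linarith [abs_sub (∫ w, q l w ∂γ) (∫ w, q l w ∂γ'), hbound γ l, hbound γ' l]

theorem abs_integral_sub_integral_le_two_pow_mul_rhoDist {q : ℕ → W → ℝ}
    (hq : ∀ l w, |q l w| ≤ 1) (γ γ' : Measure W) [IsProbabilityMeasure γ]
    [IsProbabilityMeasure γ'] (l : ℕ) :
    |(∫ w, q l w ∂γ) - ∫ w, q l w ∂γ'| ≤ 2 ^ (l + 1) * rhoDist q γ γ' := by
  calc |(∫ w, q l w ∂γ) - ∫ w, q l w ∂γ'|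
      = 2 ^ (l + 1) * ((1 / 2 : ℝ) ^ (l + 1) * |(∫ w, q l w ∂γ) - ∫ w, q l w ∂γ'|) := by
        rw [← mul_assoc, ← mul_pow]; norm_num
    _ ≤ 2 ^ (l + 1) * rhoDist q γ γ' := by
        gcongr
        exact (summable_rhoDist_term hq γ γ').le_tsum l fun j _ => by positivity

omit [MeasurableSpace W] in
theorem IsTestSequence.exists_smul_abs_sub_le [PseudoMetricSpace W] [CompactSpace W]
    {q : ℕ → W → ℝ} (hq : IsTestSequence q) {k : W → ℝ} (hk : Continuous k) {η : ℝ}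
    (hη : 0 < η) : ∃ N : ℝ, 0 < N ∧ ∃ l, ∀ w, |k w - N * q l w| ≤ η := by
  obtain ⟨B, hB⟩ := isCompact_univ.exists_bound_of_continuousOn hk.continuousOn
  have hN : 0 < |B| + 1 := by positivity
  obtain ⟨l, hl⟩ := hq.2.2 (fun w => k w / (|B| + 1)) (hk.div_const _)
    (fun w => by
      rw [abs_div, abs_of_pos hN, div_le_one hN]
      linarith [hB w (mem_univ w), le_abs_self B, Real.norm_eq_abs (k w)])
    (η / (|B| + 1)) (by positivity)
  refine ⟨|B| + 1, hN, l, fun w => ?_⟩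
  calc |k w - (|B| + 1) * q l w| = (|B| + 1) * |q l w - k w / (|B| + 1)| := by
        rw [abs_sub_comm, ← abs_of_pos hN, ← abs_mul, abs_of_pos hN]
        congr 1
        field_simp
    _ ≤ (|B| + 1) * (η / (|B| + 1)) := by gcongr; exact hl w
    _ = η := by field_simp

theorem IsTestSequence.abs_integral_sub_integral_le [PseudoMetricSpace W] [CompactSpace W]
    [BorelSpace W] {q : ℕ → W → ℝ} (hq : IsTestSequence q) {k : W → ℝ} (hk : Continuous k)
    {η : ℝ} (hη : 0 < η) :
    ∃ B : ℝ, 0 ≤ B ∧ ∀ (γ γ' : Measure W) [IsProbabilityMeasure γ] [IsProbabilityMeasure γ'],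
      |(∫ w, k w ∂γ) - ∫ w, k w ∂γ'| ≤ η + B * rhoDist q γ γ' := by
  obtain ⟨N, hN, l, hl⟩ := hq.exists_smul_abs_sub_le hk (half_pos hη)
  refine ⟨N * 2 ^ (l + 1), by positivity, fun γ γ' _ _ => ?_⟩
  have hqc : Continuous (q l) := let ⟨_, hK⟩ := hq.1 l; hK.continuous
  have happrox (ν : Measure W) [IsProbabilityMeasure ν] :
      |(∫ w, k w ∂ν) - N * ∫ w, q l w ∂ν| ≤ η / 2 := by
    rw [← integral_const_mul]
    exact norm_integral_sub_integral_le_of_forall_norm_sub_le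
      (hk.integrable_of_hasCompactSupport (.of_compactSpace k))
      ((hqc.integrable_of_hasCompactSupport (.of_compactSpace (q l))).const_mul N) hl
  have hmid : |N * (∫ w, q l w ∂γ) - N * ∫ w, q l w ∂γ'| ≤ N * 2 ^ (l + 1) * rhoDist q γ γ' := by
    rw [← mul_sub, abs_mul, abs_of_pos hN, mul_assoc]
    gcongr
    exact abs_integral_sub_integral_le_two_pow_mul_rhoDist hq.2.1 γ γ' l
  have hγ := abs_le.1 (happrox γ)
  have hγ' := abs_le.1 (happrox γ')
  have := abs_le.1 hmid
  exact abs_le.2 ⟨by linarith, by linarith⟩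

theorem isProbabilityMeasure_occupOn {w : ℝ → W} {S : ℝ} (hS : 0 < S)
    (hw : AEMeasurable w (volume.restrict (Icc 0 S))) : IsProbabilityMeasure (occupOn w S) := by
  refine ⟨?_⟩
  rw [occupOn, Measure.smul_apply, Measure.map_apply_of_aemeasurable hw MeasurableSet.univ,
    preimage_univ, Measure.restrict_apply_univ, Real.volume_Icc, sub_zero, smul_eq_mul]
  exact ENNReal.inv_mul_cancel (by simpa using hS) ENNReal.ofReal_ne_top

theorem integral_occupOn [TopologicalSpace W] [OpensMeasurableSpace W] {w : ℝ → W} {S : ℝ}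
    (hS : 0 < S) (hw : AEMeasurable w (volume.restrict (Icc 0 S))) {k : W → ℝ}
    (hk : Continuous k) : ∫ x, k x ∂(occupOn w S) = S⁻¹ * ∫ t in (0 : ℝ)..S, k (w t) := by
  rw [occupOn, integral_smul_measure, integral_map hw hk.aestronglyMeasurable,
    intervalIntegral.integral_of_le hS.le, integral_Icc_eq_integral_Ioc, ENNReal.toReal_inv,
    ENNReal.toReal_ofReal hS.le, smul_eq_mul]

end Occupational

section Sampling

theorem abs_integral_sub_integral_le_of_forall_Ioo {h h' : ℝ → ℝ} {η S : ℝ} (hS : 0 ≤ S)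
    (hi : IntervalIntegrable h volume 0 S) (hi' : IntervalIntegrable h' volume 0 S)
    (hη : ∀ t ∈ Ioo 0 S, |h t - h' t| ≤ η) :
    |(∫ t in (0 : ℝ)..S, h t) - ∫ t in (0 : ℝ)..S, h' t| ≤ η * S := by
  rw [← intervalIntegral.integral_sub hi hi']
  have hle := intervalIntegral.norm_integral_le_of_norm_le_const_ae (a := 0) (b := S)
    (f := fun t => h t - h' t) (C := η) ?_
  · rwa [sub_zero, abs_of_nonneg hS] at hle
  filter_upwards [compl_mem_ae_iff.2 (measure_singleton S)] with t hne ht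
  rw [uIoc_of_le hS] at ht
  exact hη t ⟨ht.1, lt_of_le_of_ne ht.2 hne⟩

theorem integral_step_eq_mul_integral_comp {ε : ℝ} (hε : ε ≠ 0) (h : ℝ → ℝ) (l D : ℝ) :
    ∫ t in (l * D)..((l + 1) * D), h t = ε * ∫ τ in (0 : ℝ)..(D / ε), h (l * D + ε * τ) := by
  have hsubst := intervalIntegral.smul_integral_comp_add_mul (a := 0) (b := D / ε) h ε (l * D)
  rw [mul_zero, add_zero, mul_div_cancel₀ _ hε, ← add_one_mul, smul_eq_mul] at hsubst
  exact hsubst.symm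

/-- The last time before `s` on the grid `{l D : l ∈ ℕ}` (for `D > 0` and `s ≥ 0`). -/
noncomputable def sampleTime (D s : ℝ) : ℝ := ⌊s / D⌋₊ * D

variable {D : ℝ}

theorem sampleTime_nonneg (hD : 0 < D) (s : ℝ) : 0 ≤ sampleTime D s := by
  unfold sampleTime; positivity

theorem sampleTime_le (hD : 0 < D) {s : ℝ} (hs : 0 ≤ s) : sampleTime D s ≤ s := by
  rw [sampleTime, ← le_div_iff₀ hD]; exact Nat.floor_le (by positivity)

theorem lt_sampleTime_add (hD : 0 < D) (s : ℝ) : s < sampleTime D s + D := by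
  rw [sampleTime, ← add_one_mul, ← div_lt_iff₀ hD]; exact Nat.lt_floor_add_one _

theorem abs_sub_sampleTime_le (hD : 0 < D) {s : ℝ} (hs : 0 ≤ s) : |s - sampleTime D s| ≤ D := by
  rw [abs_of_nonneg (sub_nonneg.2 (sampleTime_le hD hs))]
  linarith [lt_sampleTime_add hD s]

theorem sampleTime_eq (hD : 0 < D) {s : ℝ} {l : ℕ} (hs : s ∈ Ico (l * D) ((l + 1) * D)) :
    sampleTime D s = l * D := by
  have hfloor : ⌊s / D⌋₊ = l := by
    rw [Nat.floor_eq_iff (div_nonneg (le_trans (by positivity) hs.1) hD.le)]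
    exact ⟨(le_div_iff₀ hD).2 hs.1, (div_lt_iff₀ hD).2 hs.2⟩
  rw [sampleTime, hfloor]

theorem stronglyMeasurable_comp_sampleTime {E : Type*} [TopologicalSpace E]
    [TopologicalSpace.PseudoMetrizableSpace E] [SecondCountableTopology E] (c : ℝ → E) (D : ℝ) :
    StronglyMeasurable fun s => c (sampleTime D s) := by
  borelize E
  have hseq : Measurable fun l : ℕ => c (l * D) := measurable_from_top
  exact (hseq.comp (Nat.measurable_floor.comp (measurable_id.div_const D))).stronglyMeasurable

theorem integral_step_comp_sampleTime (hD : 0 < D) (c : ℝ → ℝ) (l : ℕ) :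
    ∫ s in (l * D)..((l + 1) * D), c (sampleTime D s) = D * c (l * D) := by
  have hle : l * D ≤ (l + 1) * D := by linarith
  rw [intervalIntegral.integral_congr_ae (g := fun _ => c (l * D))]
  · rw [intervalIntegral.integral_const, smul_eq_mul]; ring
  filter_upwards [compl_mem_ae_iff.2 (measure_singleton ((l + 1) * D))] with s hne hs
  rw [uIoc_of_le hle] at hs
  rw [sampleTime_eq hD ⟨hs.1.le, lt_of_le_of_ne hs.2 hne⟩]

theorem abs_integral_le_of_forall_abs_integral_step_le {h : ℝ → ℝ} {B η : ℝ} (hη : 0 ≤ η)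
    (hD : 0 < D) (hm : AEStronglyMeasurable h (volume.restrict (Ici 0)))
    (hB : ∀ t, 0 ≤ t → |h t| ≤ B)
    (hstep : ∀ l : ℕ, |∫ t in (l * D)..((l + 1) * D), h t| ≤ η * D) {t : ℝ} (ht : 0 ≤ t) :
    |∫ s in (0 : ℝ)..t, h s| ≤ η * t + B * D := by
  have hint {a b : ℝ} (ha : 0 ≤ a) (hb : 0 ≤ b) : IntervalIntegrable h volume a b :=
    intervalIntegrable_of_forall_norm_le hm hB ha hb
  have hsample := sampleTime_nonneg hD t
  have hB0 : 0 ≤ B := (abs_nonneg _).trans (hB 0 le_rfl)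
  have hsteps : |∫ s in (0 : ℝ)..sampleTime D t, h s| ≤ η * sampleTime D t := by
    have hsum := intervalIntegral.sum_integral_adjacent_intervals (f := h) (μ := volume)
      (a := fun l : ℕ => (l : ℝ) * D) (n := ⌊t / D⌋₊)
      (fun k _ => hint (by positivity) (by positivity))
    simp only [Nat.cast_zero, zero_mul, Nat.cast_add, Nat.cast_one] at hsum
    rw [sampleTime, ← hsum]
    refine (Finset.abs_sum_le_sum_abs _ _).trans
      ((Finset.sum_le_sum fun l _ => hstep l).trans_eq ?_)
    rw [Finset.sum_const, Finset.card_range, nsmul_eq_mul]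
    ring
  have hrest : |∫ s in (sampleTime D t)..t, h s| ≤ B * |t - sampleTime D t| :=
    intervalIntegral.norm_integral_le_of_norm_le_const (f := h) fun s hs =>
      hB s ((le_min hsample ht).trans hs.1.le)
  rw [← intervalIntegral.integral_add_adjacent_intervals (hint le_rfl hsample) (hint hsample ht)]
  refine (abs_add_le _ _).trans (add_le_add (hsteps.trans ?_) (hrest.trans ?_))
  · have := sampleTime_le hD ht; gcongr
  · have := abs_sub_sampleTime_le hD ht; gcongr

end Sampling

namespace SPProblem

section StepSize

variable {L : ℝ}

theorem tendsto_log_one_div_nhdsGT_zero :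
    Tendsto (fun ε : ℝ => Real.log (1 / ε)) (𝓝[>] 0) atTop := by
  simp only [one_div]
  exact Real.tendsto_log_atTop.comp tendsto_inv_nhdsGT_zero

theorem stepSize_div {ε : ℝ} (hε : ε ≠ 0) : stepSize L ε / ε = Real.log (1 / ε) / (2 * L) := by
  rw [stepSize]; field_simp

theorem tendsto_stepSize_div (hL : 0 < L) :
    Tendsto (fun ε => stepSize L ε / ε) (𝓝[>] 0) atTop := by
  refine (tendsto_log_one_div_nhdsGT_zero.atTop_div_const
    (show 0 < 2 * L by positivity)).congr' ?_
  filter_upwards [self_mem_nhdsWithin] with ε hε using (stepSize_div (ne_of_gt hε)).symm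

theorem eventually_stepSize_pos (hL : 0 < L) : ∀ᶠ ε in 𝓝[>] (0 : ℝ), 0 < stepSize L ε := by
  filter_upwards [self_mem_nhdsWithin, tendsto_log_one_div_nhdsGT_zero.eventually_gt_atTop 0]
    with ε hε hlog
  have : 0 < ε := hε
  unfold stepSize; positivity

theorem tendsto_stepSize (hL : 0 < L) : Tendsto (stepSize L) (𝓝[>] 0) (𝓝 0) := by
  have hlim := ((Real.tendsto_pow_mul_exp_neg_atTop_nhds_zero 1).comp
    tendsto_log_one_div_nhdsGT_zero).const_mul (1 / (2 * L))
  rw [mul_zero] at hlim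
  refine hlim.congr' ?_
  filter_upwards [self_mem_nhdsWithin] with ε hε
  simp only [Function.comp_apply, one_div, Real.log_inv, neg_neg, Real.exp_log hε, stepSize]
  field_simp

theorem exp_mul_stepSize_div (hL : 0 < L) {ε : ℝ} (hε : 0 < ε) :
    Real.exp (L * (stepSize L ε / ε)) = Real.exp (-(1 / 2 * Real.log (1 / ε))) / ε := by
  have hexponent : L * (Real.log (1 / ε) / (2 * L)) = 1 / 2 * Real.log (1 / ε) := by field_simp
  rw [stepSize_div hε.ne', hexponent, eq_div_iff hε.ne']
  nth_rw 2 [← Real.exp_log hε]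
  rw [← Real.exp_add, one_div ε, Real.log_inv]
  congr 1
  ring

theorem tendsto_stepSize_mul_exp (hL : 0 < L) (M : ℝ) :
    Tendsto (fun ε => L * (M * stepSize L ε) * (stepSize L ε / ε)
      * Real.exp (L * (stepSize L ε / ε))) (𝓝[>] 0) (𝓝 0) := by
  have hlim := ((Real.tendsto_pow_mul_exp_neg_atTop_nhds_zero 2).comp
    (tendsto_log_one_div_nhdsGT_zero.const_mul_atTop one_half_pos)).const_mul (M / L)
  rw [mul_zero] at hlim
  refine hlim.congr' ?_
  filter_upwards [self_mem_nhdsWithin] with ε (hε : 0 < ε)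
  rw [exp_mul_stepSize_div hL hε, stepSize_div hε.ne', stepSize]
  simp only [Function.comp_apply]
  field_simp

end StepSize

end SPProblem

namespace SPProblem

variable {U : Type*} {m n : ℕ} [MetricSpace U] [MeasurableSpace U] {P : SPProblem U m n}

namespace Standing

theorem isCompact_prod [CompactSpace U] (hP : P.Standing) :
    IsCompact ((univ : Set U) ×ˢ P.Y ×ˢ P.Z) :=
  isCompact_univ.prod (hP.Y_compact.prod hP.Z_compact)

theorem exists_norm_le [CompactSpace U] (hP : P.Standing) {V : Type*} [NormedAddCommGroup V]
    {h : U × Euc m × Euc n → V} (hh : Continuous h) :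
    ∃ B : ℝ≥0, ∀ u, ∀ y ∈ P.Y, ∀ z ∈ P.Z, ‖h (u, y, z)‖ ≤ B := by
  obtain ⟨B, hB⟩ := hP.isCompact_prod.exists_bound_of_continuousOn hh.continuousOn
  exact ⟨B.toNNReal, fun u y hy z hz =>
    (hB (u, y, z) ⟨mem_univ _, hy, hz⟩).trans (Real.le_coe_toNNReal B)⟩

theorem compactSpace_Y (hP : P.Standing) : CompactSpace P.Y :=
  isCompact_iff_compactSpace.1 hP.Y_compact

theorem compactSpace_Z (hP : P.Standing) : CompactSpace P.Z :=
  isCompact_iff_compactSpace.1 hP.Z_compact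

end Standing

section Trajectories

variable {ε : ℝ} {u : ℝ → U} {y : ℝ → P.Y} {z : ℝ → P.Z}

theorem aestronglyMeasurable_comp_triple [SecondCountableTopology U] [OpensMeasurableSpace U]
    {y : ℝ → Euc m} {z : ℝ → Euc n} (hu : Measurable u) (hy : ContinuousOn y (Ici 0))
    (hz : ContinuousOn z (Ici 0)) {V : Type*} [TopologicalSpace V]
    [TopologicalSpace.PseudoMetrizableSpace V] [SecondCountableTopology V]
    {p : U × Euc m × Euc n → V} (hp : Continuous p) :
    AEStronglyMeasurable (fun t => p (u t, y t, z t)) (volume.restrict (Ici 0)) := by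
  borelize V
  have htriple : AEMeasurable (fun t => (u t, y t, z t)) (volume.restrict (Ici 0)) :=
    hu.aemeasurable.prodMk ((hy.aemeasurable measurableSet_Ici).prodMk
      (hz.aemeasurable measurableSet_Ici))
  exact (hp.measurable.comp_aemeasurable htriple).aestronglyMeasurable

theorem IsSPTriple.aestronglyMeasurable [SecondCountableTopology U] [OpensMeasurableSpace U]
    {y : ℝ → Euc m} {z : ℝ → Euc n} (h : P.IsSPTriple ε u y z) {V : Type*} [TopologicalSpace V]
    [TopologicalSpace.PseudoMetrizableSpace V] [SecondCountableTopology V]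
    {p : U × Euc m × Euc n → V} (hp : Continuous p) :
    AEStronglyMeasurable (fun t => p (u t, y t, z t)) (volume.restrict (Ici 0)) :=
  aestronglyMeasurable_comp_triple h.1 h.2.2.2.1.continuousOn h.2.2.2.2.continuousOn hp

omit [MetricSpace U] in
theorem IsSPTriple.norm_slow_sub_le (h : P.IsSPTriple ε u (fun t => y t) (fun t => z t)) {M : ℝ}
    (hM : ∀ u, ∀ y ∈ P.Y, ∀ z ∈ P.Z, ‖P.g (u, y, z)‖ ≤ M) {a b : ℝ} (ha : 0 ≤ a) (hb : 0 ≤ b) :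
    ‖(z b : Euc n) - z a‖ ≤ M * |b - a| :=
  h.2.2.2.2.norm_sub_le (fun t _ => hM _ _ (y t).2 _ (z t).2) ha hb

omit [MetricSpace U] in
theorem IsAssocAdmissible.aemeasurable {ζ : P.Z} (h : P.IsAssocAdmissible ζ u y) :
    AEMeasurable (fun τ => (u τ, y τ)) (volume.restrict (Ici 0)) := by
  have hy : ContinuousOn y (Ici 0) :=
    Topology.IsInducing.subtypeVal.continuousOn_iff.2 h.2.continuousOn
  exact h.1.aemeasurable.prodMk (hy.aemeasurable measurableSet_Ici)

theorem IsAssocAdmissible.aestronglyMeasurable [SecondCountableTopology U]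
    [OpensMeasurableSpace U] {ζ : P.Z} (h : P.IsAssocAdmissible ζ u y) {V : Type*}
    [TopologicalSpace V] [TopologicalSpace.PseudoMetrizableSpace V] [SecondCountableTopology V]
    {p : U × Euc m × Euc n → V} (hp : Continuous p) :
    AEStronglyMeasurable (fun t => p (u t, y t, ζ)) (volume.restrict (Ici 0)) :=
  aestronglyMeasurable_comp_triple h.1 h.2.continuousOn continuousOn_const hp

end Trajectories

section Average

omit [MetricSpace U] in
theorem norm_avg_le {V : Type*} [NormedAddCommGroup V] [NormedSpace ℝ V]
    {p : U × Euc m × Euc n → V} {B : ℝ} (hB : ∀ u, ∀ y ∈ P.Y, ∀ z ∈ P.Z, ‖p (u, y, z)‖ ≤ B)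
    (ν : ProbabilityMeasure (U × P.Y)) (ζ : P.Z) : ‖P.avg p ν ζ‖ ≤ B := by
  simpa [avg] using norm_integral_le_of_norm_le_const (μ := (ν : Measure (U × P.Y)))
    (Eventually.of_forall fun x => hB x.1 x.2 x.2.2 ζ ζ.2)

variable [CompactSpace U] [BorelSpace U]

theorem Standing.integrable_section (hP : P.Standing) {V : Type*} [NormedAddCommGroup V]
    {p : U × Euc m × Euc n → V} (hp : Continuous p) (ν : Measure (U × P.Y))
    [IsFiniteMeasure ν] (ζ : P.Z) :
    Integrable (fun x : U × P.Y => p (x.1, (x.2 : Euc m), (ζ : Euc n))) ν := by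
  have := hP.compactSpace_Y
  exact (by fun_prop : Continuous fun x : U × P.Y => p (x.1, (x.2 : Euc m), (ζ : Euc n)))
    |>.integrable_of_hasCompactSupport (.of_compactSpace _)

theorem Standing.norm_avg_sub_avg_le (hP : P.Standing) {V : Type*} [NormedAddCommGroup V]
    [NormedSpace ℝ V] {p p' : U × Euc m × Euc n → V} (hp : Continuous p) (hp' : Continuous p')
    {η : ℝ} (hη : ∀ u, ∀ y ∈ P.Y, ∀ z ∈ P.Z, ‖p (u, y, z) - p' (u, y, z)‖ ≤ η)
    (ν : ProbabilityMeasure (U × P.Y)) (ζ : P.Z) : ‖P.avg p ν ζ - P.avg p' ν ζ‖ ≤ η :=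
  norm_integral_sub_integral_le_of_forall_norm_sub_le (hP.integrable_section hp _ ζ)
    (hP.integrable_section hp' _ ζ) fun x => hη x.1 x.2 x.2.2 ζ ζ.2

theorem Standing.avg_apply (hP : P.Standing) {k : ℕ} {p : U × Euc m × Euc n → Euc k}
    (hp : Continuous p) (ν : ProbabilityMeasure (U × P.Y)) (ζ : P.Z) (i : Fin k) :
    P.avg p ν ζ i = P.avg (fun x => p x i) ν ζ :=
  ((EuclideanSpace.proj (𝕜 := ℝ) i).integral_comp_comm
    (hP.integrable_section hp (ν : Measure (U × P.Y)) ζ)).symm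

end Average

section Steering

variable [CompactSpace U] [BorelSpace U] {q : ℕ → U × P.Y → ℝ}
  {μ : P.Z → ProbabilityMeasure (U × P.Y)} {us : P.Y → P.Z → ℝ → U} {ys : P.Y → P.Z → ℝ → P.Y}

theorem IsUniformSteering.eventually_abs_average_sub_integral_le (hP : P.Standing)
    (hq : IsTestSequence q) (hs : P.IsUniformSteering q μ us ys) {k : U × P.Y → ℝ}
    (hk : Continuous k) {η : ℝ} (hη : 0 < η) :
    ∀ᶠ S in atTop, ∀ y ζ, |(S⁻¹ * ∫ τ in (0 : ℝ)..S, k (us y ζ τ, ys y ζ τ))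
      - ∫ x, k x ∂(μ ζ : Measure (U × P.Y))| ≤ η := by
  have := hP.compactSpace_Y
  obtain ⟨hadm, φ, hφ, hρ⟩ := hs
  obtain ⟨B, hB, hkB⟩ := hq.abs_integral_sub_integral_le hk (half_pos hη)
  have hφB : ∀ᶠ S in atTop, B * φ S < η / 2 :=
    (hφ.const_mul B).eventually_lt_const (by rw [mul_zero]; positivity)
  filter_upwards [hφB, eventually_gt_atTop 0] with S hS hS0 y ζ
  have hw := ((hadm y ζ).1.aemeasurable).mono_measure
    (Measure.restrict_mono (Icc_subset_Ici_self : Icc 0 S ⊆ Ici 0) le_rfl)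
  have := isProbabilityMeasure_occupOn hS0 hw
  rw [← integral_occupOn hS0 hw hk]
  have := mul_le_mul_of_nonneg_left (hρ S hS0 y ζ) hB
  linarith [hkB (occupOn (fun τ => (us y ζ τ, ys y ζ τ)) S) (μ ζ)]

/-- Uniformity in `ζ` comes from the compactness of `{p(·, ·, ζ) : ζ ∈ Z}` in `C(U × Y)`. -/
theorem IsUniformSteering.eventually_abs_average_sub_avg_le (hP : P.Standing)
    (hq : IsTestSequence q) (hs : P.IsUniformSteering q μ us ys) {p : U × Euc m × Euc n → ℝ}
    (hp : Continuous p) {η : ℝ} (hη : 0 < η) :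
    ∀ᶠ S in atTop, ∀ y ζ,
      |(S⁻¹ * ∫ τ in (0 : ℝ)..S, p (us y ζ τ, ys y ζ τ, ζ)) - P.avg p (μ ζ) ζ| ≤ η := by
  have := hP.compactSpace_Y
  have := hP.compactSpace_Z
  let H : C(P.Z, C(U × P.Y, ℝ)) := ContinuousMap.curry
    ⟨fun x : P.Z × (U × P.Y) => p (x.2.1, x.2.2, x.1), by fun_prop⟩
  obtain ⟨N, -, hN, hcover⟩ := (isCompact_range H.continuous).finite_cover_balls
    (show 0 < η / 3 by positivity)
  filter_upwards [(eventually_all_finite hN).2 fun k _ =>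
    hs.eventually_abs_average_sub_integral_le hP hq k.continuous (show 0 < η / 3 by positivity),
    eventually_gt_atTop 0] with S hS hS0 y ζ
  obtain ⟨k, hk, hζk⟩ := mem_iUnion₂.1 (hcover (mem_range_self ζ))
  have hclose (x : U × P.Y) : |H ζ x - k x| ≤ η / 3 :=
    (ContinuousMap.dist_apply_le_dist x).trans (Metric.mem_ball.1 hζk).le
  have hw := ((hs.1 y ζ).1.aemeasurable).mono_measure
    (Measure.restrict_mono (Icc_subset_Ici_self : Icc 0 S ⊆ Ici 0) le_rfl)
  have := isProbabilityMeasure_occupOn hS0 hw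
  have hint (j : C(U × P.Y, ℝ)) (ν : Measure (U × P.Y)) [IsProbabilityMeasure ν] :
      Integrable j ν := j.continuous.integrable_of_hasCompactSupport (.of_compactSpace j)
  have hoccup := norm_integral_sub_integral_le_of_forall_norm_sub_le
    (hint (H ζ) (occupOn (fun τ => (us y ζ τ, ys y ζ τ)) S)) (hint k _) hclose
  have hlimit := norm_integral_sub_integral_le_of_forall_norm_sub_le
    (hint (H ζ) (μ ζ)) (hint k _) hclose
  rw [integral_occupOn hS0 hw (H ζ).continuous, integral_occupOn hS0 hw k.continuous] at hoccup
  change |(S⁻¹ * ∫ τ in (0 : ℝ)..S, H ζ (us y ζ τ, ys y ζ τ))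
    - ∫ x, H ζ x ∂(μ ζ : Measure (U × P.Y))| ≤ η
  have hmid := abs_le.1 (hS k hk y ζ)
  have hoccup := abs_le.1 hoccup
  have hlimit := abs_le.1 hlimit
  exact abs_le.2 ⟨by linarith, by linarith⟩

end Steering

section Constructed

variable {us : P.Y → P.Z → ℝ → U} {ys : P.Y → P.Z → ℝ → P.Y} {L ε : ℝ} {M : ℝ≥0} {u : ℝ → U}
  {y : ℝ → P.Y} {z : ℝ → P.Z}

omit [MetricSpace U] in
theorem IsConstructed.control_eq (hc : P.IsConstructed L us ε u y z) (hε : 0 < ε) (l : ℕ) {τ : ℝ}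
    (hτ : τ ∈ Ico 0 (stepSize L ε / ε)) :
    u (l * stepSize L ε + ε * τ)
      = us (y (l * stepSize L ε)) (z (l * stepSize L ε)) τ := by
  have hnonneg : 0 ≤ ε * τ := mul_nonneg hε.le hτ.1
  have hlt : ε * τ < stepSize L ε := by rw [mul_comm]; exact (lt_div_iff₀ hε).1 hτ.2
  rw [hc.2 l _ ⟨by linarith, by linarith⟩, add_sub_cancel_left, mul_div_cancel_left₀ _ hε.ne']

omit [MetricSpace U] in
theorem IsConstructed.norm_slow_sub_le (hc : P.IsConstructed L us ε u y z)
    (hM : ∀ u, ∀ y ∈ P.Y, ∀ z ∈ P.Z, ‖P.g (u, y, z)‖ ≤ M) (hε : 0 < ε)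
    (hD : 0 < stepSize L ε) (l : ℕ) {τ : ℝ} (hτ : τ ∈ Icc 0 (stepSize L ε / ε)) :
    ‖(z (l * stepSize L ε + ε * τ) : Euc n) - z (l * stepSize L ε)‖ ≤ M * stepSize L ε := by
  have hnonneg : 0 ≤ ε * τ := mul_nonneg hε.le hτ.1
  have hle : ε * τ ≤ stepSize L ε := by rw [mul_comm]; exact (le_div_iff₀ hε).1 hτ.2
  refine (hc.1.norm_slow_sub_le hM (by positivity) (by positivity)).trans ?_
  rw [add_sub_cancel_left, abs_of_nonneg hnonneg]
  gcongr

omit [MetricSpace U] in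
/-- In the stretched time both fast trajectories are driven by the same control and start at the
same point, and the slow variable moves by at most `M Δ(ε)`, so Grönwall's inequality applies. -/
theorem IsConstructed.norm_fast_sub_le
    (hadm : ∀ η ζ, P.IsAssocAdmissible ζ (us η ζ) (ys η ζ) ∧ ys η ζ 0 = η)
    (hL : P.IsLipConstF L) (hc : P.IsConstructed L us ε u y z)
    (hM : ∀ u, ∀ y ∈ P.Y, ∀ z ∈ P.Z, ‖P.g (u, y, z)‖ ≤ M) (hε : 0 < ε)
    (hD : 0 < stepSize L ε) (l : ℕ) :
    ∀ τ ∈ Icc 0 (stepSize L ε / ε),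
      ‖(y (l * stepSize L ε + ε * τ) : Euc m)
        - ys (y (l * stepSize L ε)) (z (l * stepSize L ε)) τ‖
      ≤ L * (M * stepSize L ε) * (stepSize L ε / ε) * Real.exp (L * (stepSize L ε / ε)) := by
  obtain ⟨⟨-, hsteered⟩, hstart⟩ := hadm (y (l * stepSize L ε)) (z (l * stepSize L ε))
  refine (hc.1.2.2.2.1.comp_add_mul (by positivity) hε).norm_sub_le_of_norm_velocity_sub_le
    hsteered (by simp [hstart]) hL.1.le (by positivity) fun τ hτ => ?_
  rw [smul_smul, mul_inv_cancel₀ hε.ne', one_smul, hc.control_eq hε l ⟨hτ.1.le, hτ.2⟩]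
  refine (hL.2 _ _ (y _).2 _ (ys _ _ _).2 _ (z _).2 _ (z _).2).trans ?_
  have := hc.norm_slow_sub_le hM hε hD l ⟨hτ.1.le, hτ.2.le⟩
  have := hL.1
  gcongr

theorem IsConstructed.dist_steered_le
    (hadm : ∀ η ζ, P.IsAssocAdmissible ζ (us η ζ) (ys η ζ) ∧ ys η ζ 0 = η)
    (hL : P.IsLipConstF L) (hc : P.IsConstructed L us ε u y z)
    (hM : ∀ u, ∀ y ∈ P.Y, ∀ z ∈ P.Z, ‖P.g (u, y, z)‖ ≤ M) (hε : 0 < ε)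
    (hD : 0 < stepSize L ε) (l : ℕ) {τ : ℝ} (hτ : τ ∈ Ico 0 (stepSize L ε / ε)) :
    dist (u (l * stepSize L ε + ε * τ), (y (l * stepSize L ε + ε * τ) : Euc m),
        (z (l * stepSize L ε + ε * τ) : Euc n))
      (us (y (l * stepSize L ε)) (z (l * stepSize L ε)) τ,
        (ys (y (l * stepSize L ε)) (z (l * stepSize L ε)) τ : Euc m),
        (z (l * stepSize L ε) : Euc n))
      ≤ max (L * (M * stepSize L ε) * (stepSize L ε / ε) * Real.exp (L * (stepSize L ε / ε)))
        (M * stepSize L ε) := by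
  rw [Prod.dist_eq, Prod.dist_eq, hc.control_eq hε l hτ, dist_self, dist_eq_norm, dist_eq_norm]
  exact max_le (le_max_of_le_right (by positivity))
    (max_le_max (hc.norm_fast_sub_le hadm hL hM hε hD l τ ⟨hτ.1, hτ.2.le⟩)
      (hc.norm_slow_sub_le hM hε hD l ⟨hτ.1, hτ.2.le⟩))

end Constructed

end SPProblem

theorem norm_le_sum_abs_apply {k : ℕ} (x : Euc k) : ‖x‖ ≤ ∑ i, |x i| := by
  conv_lhs => rw [← (EuclideanSpace.basisFun (Fin k) ℝ).sum_repr x]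
  refine (norm_sum_le _ _).trans (Finset.sum_le_sum fun i _ => ?_)
  simp [norm_smul]

theorem abs_mul_sub_mul_le_of_abs_average_sub_le {a b c ε D η : ℝ} (hε : 0 < ε) (hD : 0 < D)
    (hab : |a - b| ≤ η / 2 * (D / ε)) (hbc : |(D / ε)⁻¹ * b - c| ≤ η / 2) :
    |ε * a - D * c| ≤ η * D := by
  calc |ε * a - D * c| = |ε * (a - b) + D * ((D / ε)⁻¹ * b - c)| := by
        congr 1; field_simp; ring
    _ ≤ ε * |a - b| + D * |(D / ε)⁻¹ * b - c| := by
        refine (abs_add_le _ _).trans_eq ?_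
        rw [abs_mul, abs_mul, abs_of_pos hε, abs_of_pos hD]
    _ ≤ ε * (η / 2 * (D / ε)) + D * (η / 2) := by gcongr
    _ = η * D := by field_simp; ring

namespace SPProblem

variable {U : Type*} {m n : ℕ} [MetricSpace U] [MeasurableSpace U] {P : SPProblem U m n}

/-- As `ε → 0`, the integrals on `[0, t]` of continuous functions along `(u ε, y ε, z ε)` approach
those of their averages against `μ ζ`, where `ζ` is the value of `z ε` sampled at the last multiple
of `D ε`; the error is at most proportional to `t + 1`. -/
def IsAveragedAlongSamples (P : SPProblem U m n) (μ : P.Z → ProbabilityMeasure (U × P.Y))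
    (D : ℝ → ℝ) (u : ℝ → ℝ → U) (y : ℝ → ℝ → P.Y) (z : ℝ → ℝ → P.Z) : Prop :=
  ∀ p : U × Euc m × Euc n → ℝ, Continuous p → ∀ η : ℝ, 0 < η →
    ∀ᶠ ε in 𝓝[>] (0 : ℝ), ∀ t : ℝ, 0 ≤ t →
      |∫ s in (0 : ℝ)..t, (p (u ε s, y ε s, z ε s)
        - P.avg p (μ (z ε (sampleTime (D ε) s))) (z ε (sampleTime (D ε) s)))| ≤ η * (t + 1)

section Averaging

variable [CompactSpace U] [BorelSpace U] {q : ℕ → U × P.Y → ℝ}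
  {μ : P.Z → ProbabilityMeasure (U × P.Y)} {us : P.Y → P.Z → ℝ → U} {ys : P.Y → P.Z → ℝ → P.Y}
  {L : ℝ} {uε : ℝ → ℝ → U} {yε : ℝ → ℝ → P.Y} {zε : ℝ → ℝ → P.Z}

omit [BorelSpace U] in
theorem eventually_abs_sub_steered_le (hP : P.Standing)
    (hadm : ∀ η ζ, P.IsAssocAdmissible ζ (us η ζ) (ys η ζ) ∧ ys η ζ 0 = η)
    (hL : P.IsLipConstF L)
    (hc : ∀ᶠ ε in 𝓝[>] (0 : ℝ), P.IsConstructed L us ε (uε ε) (yε ε) (zε ε))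
    {p : U × Euc m × Euc n → ℝ} (hp : Continuous p) {η : ℝ} (hη : 0 < η) :
    ∀ᶠ ε in 𝓝[>] (0 : ℝ), ∀ l : ℕ, ∀ τ ∈ Ico 0 (stepSize L ε / ε),
      |p (uε ε (l * stepSize L ε + ε * τ), yε ε (l * stepSize L ε + ε * τ),
          zε ε (l * stepSize L ε + ε * τ))
        - p (us (yε ε (l * stepSize L ε)) (zε ε (l * stepSize L ε)) τ,
          ys (yε ε (l * stepSize L ε)) (zε ε (l * stepSize L ε)) τ,
          zε ε (l * stepSize L ε))| ≤ η := by
  obtain ⟨M, hM⟩ := hP.exists_norm_le hP.g_cont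
  obtain ⟨δ, hδ, hclose⟩ := Metric.uniformContinuousOn_iff.1
    (hP.isCompact_prod.uniformContinuousOn_of_continuous hp.continuousOn) η hη
  have hslow : ∀ᶠ ε in 𝓝[>] (0 : ℝ), M * stepSize L ε < δ :=
    ((tendsto_stepSize hL.1).const_mul (M : ℝ)).eventually_lt_const (by rwa [mul_zero])
  filter_upwards [self_mem_nhdsWithin, hc, eventually_stepSize_pos hL.1, hslow,
    (tendsto_stepSize_mul_exp hL.1 M).eventually_lt_const hδ] with ε hε hc hD hslow hfast l τ hτ
  exact (hclose _ ⟨mem_univ _, (yε ε _).2, (zε ε _).2⟩ _ ⟨mem_univ _, (ys _ _ _).2, (zε ε _).2⟩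
    ((hc.dist_steered_le hadm hL hM hε hD l hτ).trans_lt (max_lt hfast hslow))).le

theorem eventually_abs_integral_step_sub_avg_le (hP : P.Standing) (hq : IsTestSequence q)
    (hs : P.IsUniformSteering q μ us ys) (hL : P.IsLipConstF L)
    (hc : ∀ᶠ ε in 𝓝[>] (0 : ℝ), P.IsConstructed L us ε (uε ε) (yε ε) (zε ε))
    {p : U × Euc m × Euc n → ℝ} (hp : Continuous p) {η : ℝ} (hη : 0 < η) :
    ∀ᶠ ε in 𝓝[>] (0 : ℝ), ∀ l : ℕ,
      |(∫ t in (l * stepSize L ε)..((l + 1) * stepSize L ε), p (uε ε t, yε ε t, zε ε t))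
        - stepSize L ε * P.avg p (μ (zε ε (l * stepSize L ε))) (zε ε (l * stepSize L ε))|
      ≤ η * stepSize L ε := by
  obtain ⟨B, hB⟩ := hP.exists_norm_le hp
  filter_upwards [self_mem_nhdsWithin, hc, eventually_stepSize_pos hL.1,
    eventually_abs_sub_steered_le hP hs.1 hL hc hp (half_pos hη),
    (tendsto_stepSize_div hL.1).eventually
      (hs.eventually_abs_average_sub_avg_le hP hq hp (half_pos hη))] with ε hε hc hD hclose hav l
  replace hε : 0 < ε := hε
  have hclose := hclose l
  have hav := hav (yε ε (l * stepSize L ε)) (zε ε (l * stepSize L ε))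
  set D := stepSize L ε
  have hS : 0 < D / ε := div_pos hD hε
  set η₀ := yε ε (l * D)
  set ζ := zε ε (l * D)
  have hi : IntervalIntegrable (fun t => p (uε ε t, (yε ε t : Euc m), (zε ε t : Euc n))) volume
      (l * D) (l * D + D) :=
    intervalIntegrable_of_forall_norm_le (hc.1.aestronglyMeasurable hp)
      (fun t _ => hB _ _ (yε ε t).2 _ (zε ε t).2) (by positivity) (by positivity)
  have hi₁ : IntervalIntegrable (fun τ => p (uε ε (l * D + ε * τ),
      (yε ε (l * D + ε * τ) : Euc m), (zε ε (l * D + ε * τ) : Euc n))) volume 0 (D / ε) := by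
    simpa [sub_self] using (hi.comp_add_left (l * D)).comp_mul_left (c := ε)
  have hi₂ : IntervalIntegrable (fun τ => p (us η₀ ζ τ, (ys η₀ ζ τ : Euc m), (ζ : Euc n))) volume
      0 (D / ε) :=
    intervalIntegrable_of_forall_norm_le ((hs.1 η₀ ζ).1.aestronglyMeasurable hp)
      (fun t _ => hB _ _ (ys _ _ t).2 _ ζ.2) le_rfl hS.le
  have hsteered := abs_integral_sub_integral_le_of_forall_Ioo hS.le hi₁ hi₂
    fun τ hτ => hclose τ ⟨hτ.1.le, hτ.2⟩
  rw [integral_step_eq_mul_integral_comp hε.ne']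
  exact abs_mul_sub_mul_le_of_abs_average_sub_le hε hD hsteered hav

theorem IsUniformSteering.isAveragedAlongSamples (hP : P.Standing) (hq : IsTestSequence q)
    (hs : P.IsUniformSteering q μ us ys) (hL : P.IsLipConstF L)
    (hc : ∀ᶠ ε in 𝓝[>] (0 : ℝ), P.IsConstructed L us ε (uε ε) (yε ε) (zε ε)) :
    P.IsAveragedAlongSamples μ (stepSize L) uε yε zε := by
  intro p hp η hη
  obtain ⟨B, hB⟩ := hP.exists_norm_le hp
  have hsmall : ∀ᶠ ε in 𝓝[>] (0 : ℝ), (B + B) * stepSize L ε < η :=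
    ((tendsto_stepSize hL.1).const_mul (B + B : ℝ)).eventually_lt_const (by rwa [mul_zero])
  filter_upwards [hc, eventually_stepSize_pos hL.1, hsmall,
    eventually_abs_integral_step_sub_avg_le hP hq hs hL hc hp hη] with ε hc hD hsmall hstep t ht
  have hm := hc.1.aestronglyMeasurable hp
  have hms := (stronglyMeasurable_comp_sampleTime (fun s => P.avg p (μ (zε ε s)) (zε ε s))
    (stepSize L ε)).aestronglyMeasurable (μ := volume.restrict (Ici 0))
  have hbound (s : ℝ) : ‖p (uε ε s, (yε ε s : Euc m), (zε ε s : Euc n))‖ ≤ B :=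
    hB _ _ (yε ε s).2 _ (zε ε s).2
  refine (abs_integral_le_of_forall_abs_integral_step_le hη.le hD (hm.sub hms) (B := B + B)
    (fun s _ => (norm_sub_le _ _).trans (add_le_add (hbound s) (norm_avg_le hB _ _)))
    (fun l => ?_) ht).trans (by linarith)
  have hl : 0 ≤ l * stepSize L ε := by positivity
  have hl' : 0 ≤ (l + 1) * stepSize L ε := by positivity
  refine (congrArg abs ?_).trans_le (hstep l)
  rw [← integral_step_comp_sampleTime hD (fun s => P.avg p (μ (zε ε s)) (zε ε s)) l]
  exact intervalIntegral.integral_sub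
    (intervalIntegrable_of_forall_norm_le hm (fun s _ => hbound s) hl hl')
    (intervalIntegrable_of_forall_norm_le hms (fun s _ => norm_avg_le hB _ _) hl hl')

theorem IsAveragedAlongSamples.eventually_norm_integral_sub_le (hP : P.Standing) {D : ℝ → ℝ}
    (hav : P.IsAveragedAlongSamples μ D uε yε zε)
    (hsp : ∀ᶠ ε in 𝓝[>] (0 : ℝ), P.IsSPTriple ε (uε ε) (fun t => yε ε t) (fun t => zε ε t))
    {k : ℕ} {p : U × Euc m × Euc n → Euc k} (hp : Continuous p) {η : ℝ} (hη : 0 < η) :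
    ∀ᶠ ε in 𝓝[>] (0 : ℝ), ∀ t : ℝ, 0 ≤ t →
      ‖∫ s in (0 : ℝ)..t, (p (uε ε s, yε ε s, zε ε s)
        - P.avg p (μ (zε ε (sampleTime (D ε) s))) (zε ε (sampleTime (D ε) s)))‖
      ≤ η * (t + 1) := by
  have hcoord := eventually_all.2 fun i : Fin k =>
    hav (fun x => p x i) ((EuclideanSpace.proj (𝕜 := ℝ) i).continuous.comp hp) (η / (k + 1))
      (by positivity)
  obtain ⟨B, hB⟩ := hP.exists_norm_le hp
  filter_upwards [hsp, hcoord] with ε hsp hcoord t ht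
  have hi := intervalIntegrable_of_forall_norm_le (hsp.aestronglyMeasurable hp)
    (fun s _ => hB _ _ (yε ε s).2 _ (zε ε s).2) le_rfl ht
  have hi' := intervalIntegrable_of_forall_norm_le
    ((stronglyMeasurable_comp_sampleTime (fun s => P.avg p (μ (zε ε s)) (zε ε s))
      (D ε)).aestronglyMeasurable (μ := volume.restrict (Ici 0))) (fun s _ => norm_avg_le hB _ _)
    le_rfl ht
  calc _ ≤ ∑ _i : Fin k, η / (k + 1) * (t + 1) :=
        (norm_le_sum_abs_apply _).trans (Finset.sum_le_sum fun i _ => by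
          have hproj := (EuclideanSpace.proj (𝕜 := ℝ) i).intervalIntegral_comp_comm (hi.sub hi')
          have hle := hcoord i t ht
          simp only [← hP.avg_apply hp] at hle
          exact (congrArg abs hproj).ge.trans hle)
    _ = k / (k + 1) * (η * (t + 1)) := by
        rw [Finset.sum_const, Finset.card_univ, Fintype.card_fin, nsmul_eq_mul]; ring
    _ ≤ 1 * (η * (t + 1)) := by
        gcongr
        rw [div_le_one (by positivity)]
        linarith
    _ = η * (t + 1) := one_mul _

end Averaging

end SPProblem

theorem exists_pos_forall_le_abs_sub_of_notMem {s : Finset ℝ} {t : ℝ} (ht : t ∉ s) :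
    ∃ d : ℝ, 0 < d ∧ ∀ x ∈ s, d ≤ |t - x| := by
  obtain ⟨d, hd, hball⟩ := Metric.isOpen_iff.1 s.finite_toSet.isClosed.isOpen_compl t ht
  refine ⟨d, hd, fun x hx => ?_⟩
  by_contra! hlt
  rw [abs_sub_comm] at hlt
  exact hball (Metric.mem_ball.2 hlt) hx

theorem PiecewiseLipschitzTube.exists_forall_eventually_dist_le {ι Z V : Type*}
    [PseudoMetricSpace Z] [PseudoMetricSpace V] {h : Z → V} {z : ℝ → Z} {T : ℝ} {s : Finset ℝ}
    {a : ℝ → ℝ} (htube : PiecewiseLipschitzTube h z T s a) (hz : ContinuousOn z (Icc 0 T))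
    {l : Filter ι} {x : ι → ℝ → Z} {δ : ι → ℝ} (hδ : Tendsto δ l (𝓝 0))
    (hx : ∀ᶠ i in l, ∀ t ∈ Icc 0 T, (∀ p ∈ s, t ∉ Ioo (p - δ i) (p + δ i)) →
      x i t ∈ Metric.ball (z t) (a t)) :
    ∃ K : ℝ≥0, ∀ t ∈ Icc 0 T, t ∉ s → ∀ θ : ι → ℝ, (∀ᶠ i in l, θ i ∈ Icc 0 T) →
      Tendsto θ l (𝓝 t) →
      ∀ᶠ i in l, dist (h (x i (θ i))) (h (z t)) ≤ K * dist (x i (θ i)) (z t) := by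
  obtain ⟨-, -, ⟨K, hK⟩, hradius⟩ := htube
  refine ⟨K, fun t ht hts θ hθT hθ => ?_⟩
  obtain ⟨d, hd, hdist⟩ := exists_pos_forall_le_abs_sub_of_notMem hts
  obtain ⟨r, hr, hra⟩ := hradius (d / 2) (half_pos hd)
  have hzθ : Tendsto (fun i => z (θ i)) l (𝓝 (z t)) :=
    (hz t ht).tendsto.comp (tendsto_nhdsWithin_iff.2 ⟨hθ, hθT⟩)
  filter_upwards [hθT, Metric.tendsto_nhds.1 hθ (d / 2) (half_pos hd), hx,
    hδ.eventually_lt_const (half_pos hd), Metric.tendsto_nhds.1 hzθ r hr]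
    with i hθT hθt hx hδ hzr
  rw [Real.dist_eq] at hθt
  have hfar : ∀ c ≤ d / 2, ∀ p ∈ s, θ i ∉ Ioo (p - c) (p + c) := by
    intro c hc p hp hmem
    have hnear : |θ i - p| < c := abs_lt.2 ⟨by linarith [hmem.1], by linarith [hmem.2]⟩
    linarith [hdist p hp, abs_sub_le t (θ i) p, abs_sub_comm t (θ i)]
  have hθs : θ i ∉ s := fun hmem =>
    hfar (d / 2) le_rfl _ hmem ⟨by linarith, by linarith⟩
  exact (hK (θ i) hθT hθs).dist_le_mul _ (hx _ hθT (hfar _ hδ.le)) _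
    (Metric.mem_ball'.2 (hzr.trans_le (hra _ hθT (hfar _ le_rfl))))

namespace SPProblem

variable {U : Type*} {m n : ℕ} [MeasurableSpace U] {P : SPProblem U m n}

section SlowConvergence

variable {μ : P.Z → ProbabilityMeasure (U × P.Y)} {z : ℝ → P.Z} {D : ℝ → ℝ}
  {uε : ℝ → ℝ → U} {yε : ℝ → ℝ → P.Y} {zε : ℝ → ℝ → P.Z}

theorem IsAvgFlow.continuousOn (hflow : P.IsAvgFlow μ z) : ContinuousOn z (Ici 0) :=
  Topology.IsInducing.subtypeVal.continuousOn_iff.2 hflow.2.continuousOn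

theorem IsAvgFlow.norm_slow_sub_le (hflow : P.IsAvgFlow μ z) {ε : ℝ} {u : ℝ → U} {y : ℝ → P.Y}
    {x : ℝ → P.Z} (hsp : P.IsSPTriple ε u (fun t => y t) (fun t => x t)) {θ : ℝ → ℝ} {t : ℝ}
    (ht : 0 ≤ t) (hi : IntervalIntegrable (fun s => P.avg P.g (μ (x (θ s))) (x (θ s))) volume 0 t) :
    ‖(x t : Euc n) - z t‖
      ≤ ‖∫ s in (0 : ℝ)..t, (P.g (u s, y s, x s) - P.avg P.g (μ (x (θ s))) (x (θ s)))‖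
        + ∫ s in (0 : ℝ)..t,
          ‖P.avg P.g (μ (x (θ s))) (x (θ s)) - P.avg P.g (μ (z s)) (z s)‖ := by
  have hx0 : (x 0 : Euc n) = P.z0 := hsp.2.2.1
  obtain ⟨hig, hx : (x t : Euc n) = x 0 + ∫ s in (0 : ℝ)..t, P.g (u s, y s, x s)⟩ :=
    hsp.2.2.2.2 t ht
  obtain ⟨hiz, hz : (z t : Euc n) = z 0 + ∫ s in (0 : ℝ)..t, P.avg P.g (μ (z s)) (z s)⟩ :=
    hflow.2 t ht
  have hsplit : (x t : Euc n) - z t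
      = (∫ s in (0 : ℝ)..t, (P.g (u s, y s, x s) - P.avg P.g (μ (x (θ s))) (x (θ s))))
        + ∫ s in (0 : ℝ)..t,
          (P.avg P.g (μ (x (θ s))) (x (θ s)) - P.avg P.g (μ (z s)) (z s)) := by
    rw [intervalIntegral.integral_sub hig hi, intervalIntegral.integral_sub hi hiz,
      sub_add_sub_cancel, hx, hz, hx0, hflow.1, add_sub_add_left_eq_sub]
  rw [hsplit]
  exact (norm_add_le _ _).trans
    (add_le_add_right (intervalIntegral.norm_integral_le_integral_norm ht) _)

variable [MetricSpace U] [CompactSpace U] [BorelSpace U]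

theorem eventually_norm_slow_sub_le_add_integral (hP : P.Standing)
    (hsp : ∀ᶠ ε in 𝓝[>] (0 : ℝ), P.IsSPTriple ε (uε ε) (fun t => yε ε t) (fun t => zε ε t))
    (hav : P.IsAveragedAlongSamples μ D uε yε zε) (hflow : P.IsAvgFlow μ z) {T η : ℝ} (hT : 0 ≤ T)
    (hη : 0 < η) :
    ∀ᶠ ε in 𝓝[>] (0 : ℝ), ∀ t ∈ Icc 0 T, ‖(zε ε t : Euc n) - z t‖
      ≤ η + ∫ s in (0 : ℝ)..t, ‖P.avg P.g (μ (zε ε (sampleTime (D ε) s)))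
          (zε ε (sampleTime (D ε) s)) - P.avg P.g (μ (z s)) (z s)‖ := by
  obtain ⟨M, hM⟩ := hP.exists_norm_le hP.g_cont
  filter_upwards [hsp, hav.eventually_norm_integral_sub_le hP hsp hP.g_cont
    (η := η / (T + 1)) (by positivity)] with ε hsp hav t ht
  have hi := intervalIntegrable_of_forall_norm_le
    ((stronglyMeasurable_comp_sampleTime (fun s => P.avg P.g (μ (zε ε s)) (zε ε s))
      (D ε)).aestronglyMeasurable (μ := volume.restrict (Ici 0))) (fun s _ => norm_avg_le hM _ _)
    le_rfl ht.1
  refine (hflow.norm_slow_sub_le hsp ht.1 hi).trans (add_le_add_left ((hav t ht.1).trans ?_) _)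
  rw [div_mul_eq_mul_div, div_le_iff₀ (by positivity)]
  gcongr
  exact ht.2

omit [BorelSpace U] in
theorem exists_forall_eventually_norm_avg_sub_le (hP : P.Standing)
    (hsp : ∀ᶠ ε in 𝓝[>] (0 : ℝ), P.IsSPTriple ε (uε ε) (fun t => yε ε t) (fun t => zε ε t))
    (hD : ∀ᶠ ε in 𝓝[>] (0 : ℝ), 0 < D ε) (hD0 : Tendsto D (𝓝[>] 0) (𝓝 0))
    (hflow : P.IsAvgFlow μ z) (htube : P.StaysInTube μ z zε) {T : ℝ} (hT : 0 < T) :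
    ∃ K : ℝ, 0 ≤ K ∧ ∀ᵐ t ∂(volume.restrict (Icc 0 T)), ∀ η : ℝ, 0 < η → ∀ᶠ ε in 𝓝[>] (0 : ℝ),
      ‖P.avg P.g (μ (zε ε (sampleTime (D ε) t))) (zε ε (sampleTime (D ε) t))
        - P.avg P.g (μ (z t)) (z t)‖ ≤ K * ‖(zε ε t : Euc n) - z t‖ + η := by
  obtain ⟨M, hM⟩ := hP.exists_norm_le hP.g_cont
  obtain ⟨s, a, hs, δ, hδ, hin⟩ := htube T hT
  obtain ⟨K, hK⟩ := hs.exists_forall_eventually_dist_le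
    (hflow.continuousOn.mono Icc_subset_Ici_self) hδ (hin.mono fun _ h => h.2)
  refine ⟨K, K.2, ?_⟩
  filter_upwards [ae_restrict_mem measurableSet_Icc,
    compl_mem_ae_iff.2 (s.finite_toSet.measure_zero _)] with t ht hts η hη
  have hθt : Tendsto (fun ε => sampleTime (D ε) t) (𝓝[>] 0) (𝓝 t) :=
    tendsto_iff_dist_tendsto_zero.2 (squeeze_zero' (Eventually.of_forall fun _ => dist_nonneg)
      (hD.mono fun ε hε => by
        rw [dist_comm, Real.dist_eq]; exact abs_sub_sampleTime_le hε ht.1) hD0)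
  have hsmall : ∀ᶠ ε in 𝓝[>] (0 : ℝ), K * (M * D ε) < η := by
    refine Tendsto.eventually_lt_const hη ?_
    simpa using (hD0.const_mul (M : ℝ)).const_mul (K : ℝ)
  filter_upwards [hsp, hD, hsmall, hK t ht hts (fun ε => sampleTime (D ε) t)
    (hD.mono fun ε hε => ⟨sampleTime_nonneg hε t, (sampleTime_le hε ht.1).trans ht.2⟩) hθt]
    with ε hsp hD hsmall hlip
  rw [dist_eq_norm, Subtype.dist_eq, dist_eq_norm] at hlip
  have hslow := hsp.norm_slow_sub_le hM ht.1 (sampleTime_nonneg hD t)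
  calc _ ≤ K * ‖(zε ε (sampleTime (D ε) t) : Euc n) - z t‖ := hlip
    _ ≤ K * (M * D ε + ‖(zε ε t : Euc n) - z t‖) := by
        gcongr
        refine (norm_sub_le_norm_sub_add_norm_sub _ (zε ε t : Euc n) _).trans ?_
        gcongr
        refine hslow.trans ?_
        rw [abs_sub_comm]
        gcongr
        exact abs_sub_sampleTime_le hD ht.1
    _ ≤ K * ‖(zε ε t : Euc n) - z t‖ + η := by linarith

theorem eventually_norm_slow_sub_le (hP : P.Standing)
    (hsp : ∀ᶠ ε in 𝓝[>] (0 : ℝ), P.IsSPTriple ε (uε ε) (fun t => yε ε t) (fun t => zε ε t))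
    (hD : ∀ᶠ ε in 𝓝[>] (0 : ℝ), 0 < D ε) (hD0 : Tendsto D (𝓝[>] 0) (𝓝 0))
    (hav : P.IsAveragedAlongSamples μ D uε yε zε) (hflow : P.IsAvgFlow μ z)
    (htube : P.StaysInTube μ z zε) {T η : ℝ} (hT : 0 < T) (hη : 0 < η) :
    ∀ᶠ ε in 𝓝[>] (0 : ℝ), ∀ t ∈ Icc 0 T, ‖(zε ε t : Euc n) - z t‖ ≤ η := by
  obtain ⟨M, hM⟩ := hP.exists_norm_le hP.g_cont
  obtain ⟨K, hK, hKw⟩ :=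
    exists_forall_eventually_norm_avg_sub_le hP hsp hD hD0 hflow htube hT
  refine eventually_forall_le_of_approx_gronwall hK hT.le (B := M + M) ?_
    (Eventually.of_forall fun ε t _ => norm_nonneg _) (Eventually.of_forall fun ε => ?_)
    (Eventually.of_forall fun ε t _ => ?_)
    (fun κ hκ => eventually_norm_slow_sub_le_add_integral hP hsp hav hflow hT.le hκ) hKw hη
  · filter_upwards [hsp] with ε hsp
    exact ((hsp.2.2.2.2.continuousOn.sub hflow.2.continuousOn).norm).mono Icc_subset_Ici_self
  · exact ((intervalIntegrable_of_forall_norm_le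
      ((stronglyMeasurable_comp_sampleTime (fun s => P.avg P.g (μ (zε ε s)) (zε ε s))
        (D ε)).aestronglyMeasurable (μ := volume.restrict (Ici 0)))
      (fun s _ => norm_avg_le hM _ _) le_rfl hT.le).sub (hflow.2 T hT.le).1).norm
  · exact (norm_sub_le _ _).trans (add_le_add (norm_avg_le hM _ _) (norm_avg_le hM _ _))

end SlowConvergence

end SPProblem

theorem IsPiecewiseLipschitzNear.ae_continuousAt {Z V : Type*} [PseudoMetricSpace Z]
    [PseudoMetricSpace V] {h : Z → V} {z : ℝ → Z} (hh : IsPiecewiseLipschitzNear h z) :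
    ∀ᵐ t, 0 < t → ContinuousAt h (z t) := by
  have hbefore (N : ℕ) : ∀ᵐ t, t ∈ Icc (0 : ℝ) (N + 1) → ContinuousAt h (z t) := by
    obtain ⟨s, a, -, ha, ⟨K, hK⟩, -⟩ := hh (N + 1) (by positivity)
    filter_upwards [compl_mem_ae_iff.2 (s.finite_toSet.measure_zero volume)] with t hts ht
    exact (hK t ht hts).continuousOn.continuousAt (Metric.ball_mem_nhds _ (ha t ht hts))
  filter_upwards [ae_all_iff.2 hbefore] with t ht ht0
  obtain ⟨N, hN⟩ := exists_nat_ge t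
  exact ht N ⟨ht0.le, hN.trans (by linarith)⟩

namespace SPProblem

variable {U : Type*} {m n : ℕ} [MetricSpace U] [MeasurableSpace U] {P : SPProblem U m n}

section CostConvergence

variable [CompactSpace U] [BorelSpace U] {μ : P.Z → ProbabilityMeasure (U × P.Y)} {z : ℝ → P.Z}
  {D : ℝ → ℝ} {uε : ℝ → ℝ → U} {yε : ℝ → ℝ → P.Y} {zε : ℝ → ℝ → P.Z}

theorem Standing.ae_continuousAt_avg (hP : P.Standing)
    (hlip : ∀ q : U × Euc m × Euc n → ℝ, (∃ K : ℝ≥0, LipschitzWith K q) →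
      IsPiecewiseLipschitzNear (fun ζ => P.avg q (μ ζ) ζ) z)
    {p : U × Euc m × Euc n → ℝ} (hp : Continuous p) :
    ∀ᵐ t, 0 < t → ContinuousAt (fun ζ => P.avg p (μ ζ) ζ) (z t) := by
  have happrox (k : ℕ) := exists_lipschitzWith_abs_sub_le_of_isCompact hP.isCompact_prod
    hp.continuousOn (Nat.one_div_pos_of_nat (α := ℝ) (n := k))
  choose K r hr hrp using happrox
  have hunif : TendstoUniformly (fun k ζ => P.avg (r k) (μ ζ) ζ) (fun ζ => P.avg p (μ ζ) ζ)
      atTop := by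
    refine Metric.tendstoUniformly_iff.2 fun η hη => ?_
    filter_upwards [tendsto_one_div_add_atTop_nhds_zero_nat.eventually_lt_const hη] with k hk ζ
    rw [dist_comm, dist_eq_norm]
    exact (hP.norm_avg_sub_avg_le (hr k).continuous hp (fun u y hy z hz =>
      hrp k _ ⟨mem_univ u, hy, hz⟩) (μ ζ) ζ).trans_lt hk
  filter_upwards [ae_all_iff.2 fun k => (hlip (r k) ⟨K k, hr k⟩).ae_continuousAt] with t ht ht0
  refine continuousAt_of_locally_uniform_approx_of_continuousAt fun V hV => ?_
  obtain ⟨k, hk⟩ := (hunif V hV).exists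
  exact ⟨univ, univ_mem, _, ht k ht0, fun ζ _ => hk ζ⟩

theorem tendsto_slow_comp_sampleTime (hP : P.Standing)
    (hsp : ∀ᶠ ε in 𝓝[>] (0 : ℝ), P.IsSPTriple ε (uε ε) (fun t => yε ε t) (fun t => zε ε t))
    (hD : ∀ᶠ ε in 𝓝[>] (0 : ℝ), 0 < D ε) (hD0 : Tendsto D (𝓝[>] 0) (𝓝 0))
    (hav : P.IsAveragedAlongSamples μ D uε yε zε) (hflow : P.IsAvgFlow μ z)
    (htube : P.StaysInTube μ z zε) {t : ℝ} (ht : 0 < t) :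
    Tendsto (fun ε => zε ε (sampleTime (D ε) t)) (𝓝[>] 0) (𝓝 (z t)) := by
  obtain ⟨M, hM⟩ := hP.exists_norm_le hP.g_cont
  refine Metric.tendsto_nhds.2 fun η hη => ?_
  have hsmall : ∀ᶠ ε in 𝓝[>] (0 : ℝ), M * D ε < η / 2 :=
    (hD0.const_mul (M : ℝ)).eventually_lt_const (by rw [mul_zero]; positivity)
  filter_upwards [hsp, hD, hsmall, eventually_norm_slow_sub_le hP hsp hD hD0 hav hflow htube ht
    (half_pos hη)] with ε hsp hD hsmall hclose
  have hsample : ‖(zε ε (sampleTime (D ε) t) : Euc n) - zε ε t‖ ≤ M * D ε := by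
    refine (hsp.norm_slow_sub_le hM ht.le (sampleTime_nonneg hD t)).trans ?_
    rw [abs_sub_comm]
    gcongr
    exact abs_sub_sampleTime_le hD ht.le
  rw [Subtype.dist_eq, dist_eq_norm]
  linarith [norm_sub_le_norm_sub_add_norm_sub (zε ε (sampleTime (D ε) t) : Euc n) (zε ε t) (z t),
    hclose t ⟨ht.le, le_rfl⟩]

theorem tendsto_integral_discounted_avg_comp_sampleTime (hP : P.Standing)
    (hsp : ∀ᶠ ε in 𝓝[>] (0 : ℝ), P.IsSPTriple ε (uε ε) (fun t => yε ε t) (fun t => zε ε t))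
    (hD : ∀ᶠ ε in 𝓝[>] (0 : ℝ), 0 < D ε) (hD0 : Tendsto D (𝓝[>] 0) (𝓝 0))
    (hav : P.IsAveragedAlongSamples μ D uε yε zε) (hflow : P.IsAvgFlow μ z)
    (htube : P.StaysInTube μ z zε)
    (hlip : ∀ q : U × Euc m × Euc n → ℝ, (∃ K : ℝ≥0, LipschitzWith K q) →
      IsPiecewiseLipschitzNear (fun ζ => P.avg q (μ ζ) ζ) z) :
    Tendsto (fun ε => ∫ t in Ioi (0 : ℝ), Real.exp (-(P.C * t)) *
        P.avg P.G (μ (zε ε (sampleTime (D ε) t))) (zε ε (sampleTime (D ε) t)))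
      (𝓝[>] 0) (𝓝 (P.avgCost (fun t => μ (z t)) z)) := by
  obtain ⟨B, hB⟩ := hP.exists_norm_le hP.G_cont
  refine tendsto_integral_filter_of_dominated_convergence (fun t => Real.exp (-(P.C * t)) * B)
    (Eventually.of_forall fun ε => ?_)
    (Eventually.of_forall fun ε => Eventually.of_forall fun t => ?_)
    ((integrableOn_exp_neg_mul hP.C_pos).mul_const _) ?_
  · exact (by fun_prop : Continuous fun t : ℝ => Real.exp (-(P.C * t))).aestronglyMeasurable.mul
      (stronglyMeasurable_comp_sampleTime (fun s => P.avg P.G (μ (zε ε s)) (zε ε s))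
        (D ε)).aestronglyMeasurable
  · rw [norm_mul, Real.norm_of_nonneg (Real.exp_pos _).le]
    gcongr
    exact norm_avg_le hB _ _
  · rw [ae_restrict_iff' measurableSet_Ioi]
    filter_upwards [hP.ae_continuousAt_avg hlip hP.G_cont] with t hcont ht
    exact ((hcont ht).tendsto.comp
      (tendsto_slow_comp_sampleTime hP hsp hD hD0 hav hflow htube ht)).const_mul _

theorem IsAveragedAlongSamples.tendsto_cost_sub (hP : P.Standing)
    (hsp : ∀ᶠ ε in 𝓝[>] (0 : ℝ), P.IsSPTriple ε (uε ε) (fun t => yε ε t) (fun t => zε ε t))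
    (hav : P.IsAveragedAlongSamples μ D uε yε zε) :
    Tendsto (fun ε => P.cost (uε ε) (fun t => yε ε t) (fun t => zε ε t)
        - ∫ t in Ioi (0 : ℝ), Real.exp (-(P.C * t)) *
          P.avg P.G (μ (zε ε (sampleTime (D ε) t))) (zε ε (sampleTime (D ε) t)))
      (𝓝[>] 0) (𝓝 0) := by
  obtain ⟨B, hB⟩ := hP.exists_norm_le hP.G_cont
  have hC := hP.C_pos
  refine Metric.nhds_basis_closedBall.tendsto_right_iff.2 fun η hη => ?_
  filter_upwards [hsp, hav P.G hP.G_cont (η / (1 + P.C⁻¹)) (by positivity)] with ε hsp hav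
  have hGm := hsp.aestronglyMeasurable hP.G_cont
  have hAm := (stronglyMeasurable_comp_sampleTime (fun s => P.avg P.G (μ (zε ε s)) (zε ε s))
    (D ε)).aestronglyMeasurable (μ := volume.restrict (Ici 0))
  have hGB (t : ℝ) : |P.G (uε ε t, (yε ε t : Euc m), (zε ε t : Euc n))| ≤ B :=
    hB _ _ (yε ε t).2 _ (zε ε t).2
  have hIoi : volume.restrict (Ioi (0 : ℝ)) ≤ volume.restrict (Ici 0) :=
    Measure.restrict_mono Ioi_subset_Ici_self le_rfl
  rw [mem_closedBall_zero_iff, cost, ← integral_sub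
    (integrableOn_exp_neg_mul_of_bounded hC (hGm.mono_measure hIoi) fun t _ => hGB t)
    (integrableOn_exp_neg_mul_of_bounded hC (hAm.mono_measure hIoi) fun t _ => norm_avg_le hB _ _)]
  simp only [← mul_sub]
  refine (abs_integral_exp_neg_mul_le_of_forall_abs_primitive_le hC (hGm.sub hAm) (B := B + B)
    (fun t _ => (norm_sub_le _ _).trans (add_le_add (hGB t) (norm_avg_le hB _ _))) hav).trans_eq ?_
  exact div_mul_cancel₀ _ (by positivity)

theorem tendsto_cost_avgCost (hP : P.Standing)
    (hsp : ∀ᶠ ε in 𝓝[>] (0 : ℝ), P.IsSPTriple ε (uε ε) (fun t => yε ε t) (fun t => zε ε t))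
    (hD : ∀ᶠ ε in 𝓝[>] (0 : ℝ), 0 < D ε) (hD0 : Tendsto D (𝓝[>] 0) (𝓝 0))
    (hav : P.IsAveragedAlongSamples μ D uε yε zε) (hflow : P.IsAvgFlow μ z)
    (htube : P.StaysInTube μ z zε)
    (hlip : ∀ q : U × Euc m × Euc n → ℝ, (∃ K : ℝ≥0, LipschitzWith K q) →
      IsPiecewiseLipschitzNear (fun ζ => P.avg q (μ ζ) ζ) z) :
    Tendsto (fun ε => P.cost (uε ε) (fun t => yε ε t) (fun t => zε ε t)) (𝓝[>] 0)
      (𝓝 (P.avgCost (fun t => μ (z t)) z)) := by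
  simpa using (hav.tendsto_cost_sub hP hsp).add
    (tendsto_integral_discounted_avg_comp_sampleTime hP hsp hD hD0 hav hflow htube hlip)

end CostConvergence

end SPProblem

section Discount

open ProbabilityTheory

variable {C : ℝ}

theorem expMeasure_eq_withDensity :
    expMeasure C = (volume.restrict (Ici 0)).withDensity
      fun t => ENNReal.ofReal (C * Real.exp (-(C * t))) := by
  rw [← withDensity_indicator measurableSet_Ici]
  refine congrArg volume.withDensity (funext fun t => ?_)
  change exponentialPDF C t = _
  by_cases ht : 0 ≤ t
  · rw [exponentialPDF_of_nonneg ht, indicator_of_mem (mem_Ici.2 ht)]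
  · rw [exponentialPDF_of_neg (not_le.1 ht), indicator_of_notMem (by simpa using ht)]

theorem integral_expMeasure (hC : 0 < C) (h : ℝ → ℝ) :
    ∫ t, h t ∂expMeasure C = C * ∫ t in Ioi (0 : ℝ), Real.exp (-(C * t)) * h t := by
  rw [expMeasure_eq_withDensity, integral_withDensity_eq_integral_toReal_smul (by fun_prop)
    (Eventually.of_forall fun t => ENNReal.ofReal_lt_top), ← integral_const_mul,
    integral_Ici_eq_integral_Ioi]
  refine integral_congr_ae (Eventually.of_forall fun t => ?_)
  simp only [smul_eq_mul]
  rw [ENNReal.toReal_ofReal (by positivity), mul_assoc]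

theorem ae_expMeasure_nonneg : ∀ᵐ t ∂expMeasure C, 0 ≤ t := by
  rw [expMeasure_eq_withDensity]
  exact (withDensity_absolutelyContinuous _ _).ae_le (ae_restrict_mem measurableSet_Ici)

end Discount

theorem continuous_fderiv_comp_apply {X E F : Type*} [TopologicalSpace X] [NormedAddCommGroup E]
    [NormedSpace ℝ E] [NormedAddCommGroup F] [NormedSpace ℝ F] {χ : E → F} (hχ : ContDiff ℝ 1 χ)
    {a v : X → E} (ha : Continuous a) (hv : Continuous v) :
    Continuous fun x => fderiv ℝ χ (a x) (v x) :=
  (hχ.continuous_fderiv_apply one_ne_zero).comp (ha.prodMk hv)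

namespace SPProblem

variable {U : Type*} {m n : ℕ} [MetricSpace U] [MeasurableSpace U] {P : SPProblem U m n}

/-- The integral of `p (u, y, z)` against a probability measure on `U × Y × Z`. -/
noncomputable def mean (P : SPProblem U m n) (p : U × Euc m × Euc n → ℝ)
    (γ : ProbabilityMeasure (U × P.Y × P.Z)) : ℝ :=
  ∫ x, p (x.1, (x.2.1 : Euc m), (x.2.2 : Euc n)) ∂(γ : Measure (U × P.Y × P.Z))

/-- `γ` is the discounted occupational measure of `(u, y, z)`: the law of `(u, y, z)` at an
exponentially distributed random time of rate `C`. -/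
def IsDiscountedOccupational (P : SPProblem U m n) (u : ℝ → U) (y : ℝ → Euc m) (z : ℝ → Euc n)
    (γ : ProbabilityMeasure (U × P.Y × P.Z)) : Prop :=
  ∀ p : U × Euc m × Euc n → ℝ, Continuous p →
    P.mean p γ = P.C * ∫ t in Ioi (0 : ℝ), Real.exp (-(P.C * t)) * p (u t, y t, z t)

/-- The equations satisfied by the discounted occupational measures of the solutions of the
singularly perturbed system. They are multiplied by `ε` on the fast part, so that they make sense
and pass to the limit at `ε = 0`. -/
structure IsOccupationalSolution (P : SPProblem U m n) (ε : ℝ)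
    (γ : ProbabilityMeasure (U × P.Y × P.Z)) : Prop where
  fast : ∀ χ : Euc m × Euc n → ℝ, ContDiff ℝ 1 χ →
    P.mean (fun x => fderiv ℝ χ x.2 (P.f x, 0)) γ
      = ε * (P.C * (P.mean (fun x => χ x.2) γ - χ (P.y0, P.z0))
        - P.mean (fun x => fderiv ℝ χ x.2 (0, P.g x)) γ)
  slow : ∀ ψ : Euc n → ℝ, ContDiff ℝ 1 ψ →
    P.mean (fun x => fderiv ℝ ψ x.2.2 (P.g x)) γ
      = P.C * (P.mean (fun x => ψ x.2.2) γ - ψ P.z0)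

section Trajectories

variable {ε : ℝ} {u : ℝ → U} {y : ℝ → Euc m} {z : ℝ → Euc n}

theorem IsSPTriple.exists_isDiscountedOccupational [SecondCountableTopology U]
    [OpensMeasurableSpace U] (h : P.IsSPTriple ε u y z) (hC : 0 < P.C)
    (hin : ∀ t, 0 ≤ t → y t ∈ P.Y ∧ z t ∈ P.Z) : ∃ γ, P.IsDiscountedOccupational u y z γ := by
  obtain ⟨hum, -, -, hyv, hzv⟩ := h
  have hmax : MapsTo (fun t : ℝ => max t 0) univ (Ici 0) := fun t _ => le_max_right t 0
  have hmaxc : ContinuousOn (fun t : ℝ => max t 0) univ := by fun_prop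
  have hy : Measurable fun t => y (max t 0) :=
    (continuousOn_univ.1 (hyv.continuousOn.comp hmaxc hmax)).measurable
  have hz : Measurable fun t => z (max t 0) :=
    (continuousOn_univ.1 (hzv.continuousOn.comp hmaxc hmax)).measurable
  let w : ℝ → U × P.Y × P.Z := fun t => (u t, ⟨y (max t 0), (hin _ (le_max_right t 0)).1⟩,
    ⟨z (max t 0), (hin _ (le_max_right t 0)).2⟩)
  have hw : Measurable w := hum.prodMk (hy.subtype_mk.prodMk hz.subtype_mk)
  have := ProbabilityTheory.isProbabilityMeasure_expMeasure hC
  refine ⟨⟨(ProbabilityTheory.expMeasure P.C).map w,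
    Measure.isProbabilityMeasure_map hw.aemeasurable⟩, fun p hp => ?_⟩
  rw [← integral_expMeasure hC]
  change ∫ x, p (x.1, (x.2.1 : Euc m), (x.2.2 : Euc n))
    ∂(ProbabilityTheory.expMeasure P.C).map w = _
  rw [integral_map hw.aemeasurable
    (by fun_prop : Continuous fun x : U × P.Y × P.Z =>
      p (x.1, (x.2.1 : Euc m), (x.2.2 : Euc n))).aestronglyMeasurable]
  refine integral_congr_ae ?_
  filter_upwards [ae_expMeasure_nonneg] with t ht
  simp only [w, max_eq_left ht]

omit [MetricSpace U] in
theorem IsSPTriple.ae_hasDerivAt_comp (h : P.IsSPTriple ε u y z) {χ : Euc m × Euc n → ℝ}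
    (hχ : Differentiable ℝ χ) :
    ∀ᵐ t, 0 < t → HasDerivAt (fun t => χ (y t, z t))
      (fderiv ℝ χ (y t, z t) (ε⁻¹ • P.f (u t, y t, z t), P.g (u t, y t, z t))) t := by
  filter_upwards [h.2.2.2.1.ae_hasDerivAt, h.2.2.2.2.ae_hasDerivAt] with t hy hz ht
  exact (hχ _).hasFDerivAt.comp_hasDerivAt t ((hy ht).prodMk (hz ht))

variable [CompactSpace U]

theorem IsSPTriple.exists_lipschitzOnWith_comp (h : P.IsSPTriple ε u y z) (hP : P.Standing)
    (hin : ∀ t, 0 ≤ t → y t ∈ P.Y ∧ z t ∈ P.Z) {χ : Euc m × Euc n → ℝ} (hχ : ContDiff ℝ 1 χ) :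
    ∃ K : ℝ≥0, LipschitzOnWith K (fun t => χ (y t, z t)) (Ici 0) := by
  obtain ⟨Bf, hBf⟩ := hP.exists_norm_le (hP.f_cont.const_smul ε⁻¹)
  obtain ⟨Bg, hBg⟩ := hP.exists_norm_le hP.g_cont
  obtain ⟨K, hK⟩ := hχ.locallyLipschitz.locallyLipschitzOn.exists_lipschitzOnWith_of_compact
    (hP.Y_compact.prod hP.Z_compact)
  have hy := h.2.2.2.1.lipschitzOnWith fun t ht => hBf _ _ (hin t ht).1 _ (hin t ht).2
  have hz := h.2.2.2.2.lipschitzOnWith fun t ht => hBg _ _ (hin t ht).1 _ (hin t ht).2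
  exact ⟨_, hK.comp (hy.prodMk hz) fun t ht => hin t ht⟩

theorem IsDiscountedOccupational.mean_fderiv [OpensMeasurableSpace U]
    {γ : ProbabilityMeasure (U × P.Y × P.Z)} (hγ : P.IsDiscountedOccupational u y z γ)
    (hP : P.Standing) (h : P.IsSPTriple ε u y z) (hin : ∀ t, 0 ≤ t → y t ∈ P.Y ∧ z t ∈ P.Z)
    {χ : Euc m × Euc n → ℝ} (hχ : ContDiff ℝ 1 χ) :
    P.mean (fun x => fderiv ℝ χ x.2 (ε⁻¹ • P.f x, P.g x)) γ
      = P.C * (P.mean (fun x => χ x.2) γ - χ (P.y0, P.z0)) := by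
  have hd : Continuous fun x : U × Euc m × Euc n => fderiv ℝ χ x.2 (ε⁻¹ • P.f x, P.g x) :=
    continuous_fderiv_comp_apply hχ continuous_snd ((hP.f_cont.const_smul ε⁻¹).prodMk hP.g_cont)
  obtain ⟨B, hB⟩ := hP.exists_norm_le hd
  obtain ⟨K, hK⟩ := h.exists_lipschitzOnWith_comp hP hin hχ
  have hm := (h.aestronglyMeasurable hd).mono_measure
    (Measure.restrict_mono (Ioi_subset_Ici_self (a := (0 : ℝ))) le_rfl)
  have hparts := integral_exp_neg_mul_deriv hP.C_pos hK
    (h.ae_hasDerivAt_comp (hχ.differentiable one_ne_zero))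
    (integrableOn_exp_neg_mul_of_bounded hP.C_pos hm fun t ht =>
      hB _ _ (hin t ht.le).1 _ (hin t ht.le).2)
  rw [h.2.1, h.2.2.1] at hparts
  rw [hγ _ hd, hγ (fun x => χ x.2) (hχ.continuous.comp continuous_snd), hparts]
  ring

end Trajectories

section OccupationalMeasures

variable [CompactSpace U] [BorelSpace U] {γ : ProbabilityMeasure (U × P.Y × P.Z)}

theorem Standing.integrable_triple (hP : P.Standing) {V : Type*} [NormedAddCommGroup V]
    {p : U × Euc m × Euc n → V} (hp : Continuous p) (γ : Measure (U × P.Y × P.Z))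
    [IsFiniteMeasure γ] :
    Integrable (fun x : U × P.Y × P.Z => p (x.1, (x.2.1 : Euc m), (x.2.2 : Euc n))) γ := by
  have := hP.compactSpace_Y
  have := hP.compactSpace_Z
  exact (by fun_prop : Continuous fun x : U × P.Y × P.Z =>
    p (x.1, (x.2.1 : Euc m), (x.2.2 : Euc n))).integrable_of_hasCompactSupport
    (.of_compactSpace _)

theorem Standing.mean_const_mul_add (hP : P.Standing) {p p' : U × Euc m × Euc n → ℝ}
    (hp : Continuous p) (hp' : Continuous p') (c : ℝ) (γ : ProbabilityMeasure (U × P.Y × P.Z)) :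
    P.mean (fun x => c * p x + p' x) γ = c * P.mean p γ + P.mean p' γ := by
  rw [mean, integral_add ((hP.integrable_triple hp (γ : Measure _)).const_mul c)
    (hP.integrable_triple hp' (γ : Measure _)), integral_const_mul]
  rfl

theorem IsDiscountedOccupational.isOccupationalSolution {ε : ℝ} {u : ℝ → U} {y : ℝ → Euc m}
    {z : ℝ → Euc n} (hγ : P.IsDiscountedOccupational u y z γ) (hP : P.Standing) (hε : 0 < ε)
    (h : P.IsSPTriple ε u y z) (hin : ∀ t, 0 ≤ t → y t ∈ P.Y ∧ z t ∈ P.Z) :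
    P.IsOccupationalSolution ε γ where
  fast χ hχ := by
    have hsplit : (fun x => fderiv ℝ χ x.2 (ε⁻¹ • P.f x, P.g x)) = fun x =>
        ε⁻¹ * fderiv ℝ χ x.2 (P.f x, 0) + fderiv ℝ χ x.2 (0, P.g x) := by
      funext x
      rw [← smul_eq_mul, ← map_smul, ← map_add]
      simp
    have hmean := hγ.mean_fderiv hP h hin hχ
    rw [hsplit, hP.mean_const_mul_add
      (continuous_fderiv_comp_apply hχ continuous_snd (hP.f_cont.prodMk continuous_const))
      (continuous_fderiv_comp_apply hχ continuous_snd (continuous_const.prodMk hP.g_cont))]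
      at hmean
    rw [← hmean]
    field_simp
    ring
  slow ψ hψ := by
    have hd (x : U × Euc m × Euc n) : fderiv ℝ (fun w : Euc m × Euc n => ψ w.2) x.2
        (ε⁻¹ • P.f x, P.g x) = fderiv ℝ ψ x.2.2 (P.g x) := by
      rw [fderiv_fun_comp (g := ψ) (f := Prod.snd) x.2
        ((hψ.differentiable one_ne_zero) _) differentiableAt_snd, fderiv_snd]
      rfl
    simpa only [hd] using
      hγ.mean_fderiv hP h hin (χ := fun w => ψ w.2) (hψ.comp contDiff_snd)

theorem Standing.tendsto_mean (hP : P.Standing) {ι : Type*} {l : Filter ι}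
    {Γ : ι → ProbabilityMeasure (U × P.Y × P.Z)} (hΓ : Tendsto Γ l (𝓝 γ))
    {p : U × Euc m × Euc n → ℝ} (hp : Continuous p) :
    Tendsto (fun i => P.mean p (Γ i)) l (𝓝 (P.mean p γ)) := by
  have := hP.compactSpace_Y
  have := hP.compactSpace_Z
  exact ProbabilityMeasure.tendsto_iff_forall_integral_tendsto.1 hΓ
    (BoundedContinuousFunction.mkOfCompact ⟨fun x : U × P.Y × P.Z =>
      p (x.1, (x.2.1 : Euc m), (x.2.2 : Euc n)), by fun_prop⟩)

theorem IsOccupationalSolution.of_tendsto (hP : P.Standing) {ι : Type*} {l : Filter ι} [l.NeBot]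
    {e : ι → ℝ} {Γ : ι → ProbabilityMeasure (U × P.Y × P.Z)} {ε : ℝ}
    (h : ∀ i, P.IsOccupationalSolution (e i) (Γ i)) (he : Tendsto e l (𝓝 ε))
    (hΓ : Tendsto Γ l (𝓝 γ)) : P.IsOccupationalSolution ε γ where
  fast χ hχ := by
    have hfast := hP.tendsto_mean hΓ (p := fun x => fderiv ℝ χ x.2 (P.f x, 0))
      (continuous_fderiv_comp_apply hχ continuous_snd (hP.f_cont.prodMk continuous_const))
    have hslow := hP.tendsto_mean hΓ (p := fun x => fderiv ℝ χ x.2 (0, P.g x))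
      (continuous_fderiv_comp_apply hχ continuous_snd (continuous_const.prodMk hP.g_cont))
    have hvalue := hP.tendsto_mean hΓ (p := fun x => χ x.2) (hχ.continuous.comp continuous_snd)
    refine tendsto_nhds_unique hfast ?_
    simpa only [(h _).fast χ hχ] using
      he.mul (((hvalue.sub_const (χ (P.y0, P.z0))).const_mul P.C).sub hslow)
  slow ψ hψ := by
    have hslow := hP.tendsto_mean hΓ (p := fun x => fderiv ℝ ψ x.2.2 (P.g x))
      (continuous_fderiv_comp_apply hψ (continuous_snd.comp continuous_snd) hP.g_cont)
    have hvalue := hP.tendsto_mean hΓ (p := fun x => ψ x.2.2)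
      (hψ.continuous.comp (continuous_snd.comp continuous_snd))
    refine tendsto_nhds_unique hslow ?_
    simpa only [(h _).slow ψ hψ] using
      (hvalue.sub_const (ψ P.z0)).const_mul P.C

theorem Standing.exists_isOccupationalSolution_zero (hP : P.Standing) {c : ℝ}
    (hc : ∃ᶠ ε in 𝓝[>] (0 : ℝ), ∃ γ, P.IsOccupationalSolution ε γ ∧ P.mean P.G γ ≤ c) :
    ∃ γ, P.IsOccupationalSolution 0 γ ∧ P.mean P.G γ ≤ c := by
  have := hP.compactSpace_Y
  have := hP.compactSpace_Z
  obtain ⟨e, he, hsol⟩ := exists_seq_forall_of_frequently hc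
  choose Γ hΓ hle using hsol
  obtain ⟨γ, -, hγ⟩ := isCompact_univ.ultrafilter_le_nhds ((hyperfilter ℕ).map Γ) (by simp)
  have hlim : Tendsto Γ (hyperfilter ℕ) (𝓝 γ) := hγ
  have he0 : Tendsto e (hyperfilter ℕ) (𝓝 0) :=
    ((tendsto_nhdsWithin_iff.1 he).1).mono_left Nat.hyperfilter_le_atTop
  exact ⟨γ, .of_tendsto hP hΓ he0 hlim,
    le_of_tendsto (hP.tendsto_mean hlim hP.G_cont) (Eventually.of_forall hle)⟩

theorem Standing.frequently_exists_isOccupationalSolution (hP : P.Standing) {c : ℝ}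
    (hc : ∃ᶠ ε in 𝓝[>] (0 : ℝ), ∃ u y z, P.IsSPTriple ε u y z ∧ P.C * P.cost u y z ≤ c) :
    ∃ᶠ ε in 𝓝[>] (0 : ℝ), ∃ γ, P.IsOccupationalSolution ε γ ∧ P.mean P.G γ ≤ c := by
  refine (hc.and_eventually (hP.invariant.and self_mem_nhdsWithin)).mono ?_
  rintro ε ⟨⟨u, y, z, h, hle⟩, hinv, hε⟩
  obtain ⟨γ, hγ⟩ := h.exists_isDiscountedOccupational hP.C_pos (hinv u y z h)
  exact ⟨γ, hγ.isOccupationalSolution hP hε h (hinv u y z h), (hγ _ hP.G_cont).trans_le hle⟩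

end OccupationalMeasures

end SPProblem

theorem exists_seq_contDiff_forall_norm_fderiv_sub_le {E F : Type*} [NormedAddCommGroup E]
    [NormedSpace ℝ E] [FiniteDimensional ℝ E] [NormedAddCommGroup F] [NormedSpace ℝ F]
    [SecondCountableTopology F] {s : Set E} (hs : IsCompact s) :
    ∃ φ : ℕ → E → F, (∀ k, ContDiff ℝ 1 (φ k)) ∧ ∀ χ : E → F, ContDiff ℝ 1 χ →
      ∀ η : ℝ, 0 < η → ∃ k, ∀ x ∈ s, ‖fderiv ℝ χ x - fderiv ℝ (φ k) x‖ ≤ η := by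
  have := isCompact_iff_compactSpace.1 hs
  have : ProperSpace E := FiniteDimensional.proper_real E
  let D : {φ : E → F // ContDiff ℝ 1 φ} → C(s, E →L[ℝ] F) := fun φ =>
    ⟨fun x => fderiv ℝ φ.1 x, (φ.2.continuous_fderiv one_ne_zero).comp continuous_subtype_val⟩
  have : Nonempty {φ : E → F // ContDiff ℝ 1 φ} := ⟨⟨fun _ => 0, contDiff_const⟩⟩
  have : Nonempty (range D) := (range_nonempty D).to_subtype
  choose φ hφ using fun k => (TopologicalSpace.denseSeq (range D) k).2
  refine ⟨fun k => (φ k).1, fun k => (φ k).2, fun χ hχ η hη => ?_⟩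
  have hdense : DenseRange (TopologicalSpace.denseSeq (range D)) :=
    TopologicalSpace.denseRange_denseSeq (range D)
  let Dχ : range D := ⟨D ⟨χ, hχ⟩, mem_range_self _⟩
  obtain ⟨k, hk⟩ := DenseRange.exists_dist_lt (α := range D) hdense Dχ hη
  rw [Subtype.dist_eq, ← hφ k] at hk
  refine ⟨k, fun x hx => ?_⟩
  rw [← dist_eq_norm]
  exact (ContinuousMap.dist_apply_le_dist (f := D ⟨χ, hχ⟩) (g := D (φ k)) ⟨x, hx⟩).trans hk.le

section Disintegration

variable {E Ω : Type*} [MeasurableSpace E] [MeasurableSpace Ω]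

theorem exists_measurable_ae_eq_forall {ν : Measure E} [(ae ν).NeBot] {p : E → Prop}
    (hp : ∀ᵐ x ∂ν, p x) : ∃ r : E → E, Measurable r ∧ (∀ᵐ x ∂ν, r x = x) ∧ ∀ x, p (r x) := by
  classical
  obtain ⟨A, hA, hAm, hAp⟩ := hp.exists_measurable_mem
  obtain ⟨a, ha⟩ := (show ∃ᶠ x in ae ν, x ∈ A from Eventually.frequently hA).exists
  refine ⟨fun x => if x ∈ A then x else a, Measurable.ite hAm measurable_id measurable_const,
    mem_of_superset hA fun x hx => if_pos hx, fun x => ?_⟩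
  dsimp only
  split_ifs with hx
  exacts [hAp x hx, hAp a ha]

theorem ae_integral_condKernel_eq_zero [NormedAddCommGroup E] [NormedSpace ℝ E]
    [FiniteDimensional ℝ E] [BorelSpace E] [StandardBorelSpace Ω] [Nonempty Ω]
    {M : Measure (E × Ω)} [IsFiniteMeasure M] {h : E × Ω → ℝ} (hh : Integrable h M)
    (hzero : ∀ ψ : E → ℝ, ContDiff ℝ 1 ψ → HasCompactSupport ψ → ∫ x, ψ x.1 * h x ∂M = 0) :
    ∀ᵐ ζ ∂M.fst, ∫ w, h (ζ, w) ∂M.condKernel ζ = 0 := by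
  refine ae_eq_zero_of_integral_contDiff_smul_eq_zero hh.integral_condKernel.locallyIntegrable
    fun ψ hψ hψs => ?_
  obtain ⟨B, hB⟩ := hψs.exists_bound_of_continuous hψ.continuous
  have hψh : Integrable (fun x : E × Ω => ψ x.1 * h x) M :=
    hh.bdd_mul (hψ.continuous.measurable.comp measurable_fst).aestronglyMeasurable
      (Eventually.of_forall fun x => hB x.1)
  rw [← hzero ψ (hψ.of_le (by exact_mod_cast le_top)) hψs, ← Measure.integral_condKernel hψh]
  simp only [smul_eq_mul, integral_const_mul]

end Disintegration

namespace SPProblem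

variable {U : Type*} {m n : ℕ} [MetricSpace U] [MeasurableSpace U] {P : SPProblem U m n}

section MeasurableAverage

variable {V : Type*} [NormedAddCommGroup V] [NormedSpace ℝ V] [SecondCountableTopology U]
  [OpensMeasurableSpace U]

theorem stronglyMeasurable_avg {p : U × Euc m × Euc n → V} (hp : Continuous p) :
    StronglyMeasurable fun x : P.graphW => P.avg p x.1.1 x.1.2 := by
  let κ : ProbabilityTheory.Kernel P.graphW (U × P.Y) :=
    ⟨fun x => (x.1.1 : Measure (U × P.Y)),
      measurable_subtype_coe.comp (measurable_fst.comp measurable_subtype_coe)⟩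
  have : ProbabilityTheory.IsMarkovKernel κ := ⟨fun x => inferInstanceAs
    (IsProbabilityMeasure (x.1.1 : Measure (U × P.Y)))⟩
  have hmeas : StronglyMeasurable fun x : P.graphW × (U × P.Y) =>
      p (x.2.1, (x.2.2 : Euc m), (x.1.1.2 : Euc n)) :=
    hp.stronglyMeasurable.comp_measurable (by fun_prop)
  exact hmeas.integral_kernel_prod_right' (κ := κ)

end MeasurableAverage

variable [CompactSpace U] [BorelSpace U]

theorem Standing.exists_seq_mem_limitSet (hP : P.Standing) :
    ∃ φ : ℕ → Euc m → ℝ, (∀ k, ContDiff ℝ 1 (φ k)) ∧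
      ∀ (ζ : P.Z) (ν : ProbabilityMeasure (U × P.Y)),
        (∀ k, P.avg (fun x => fderiv ℝ (φ k) x.2.1 (P.f x)) ν ζ = 0) → ν ∈ P.limitSet ζ := by
  obtain ⟨B, hB⟩ := hP.exists_norm_le hP.f_cont
  obtain ⟨φ, hφ, hdense⟩ := exists_seq_contDiff_forall_norm_fderiv_sub_le (F := ℝ) hP.Y_compact
  refine ⟨φ, hφ, fun ζ ν hν χ hχ => norm_le_zero_iff.1 (le_of_forall_pos_le_add fun η hη => ?_)⟩
  obtain ⟨k, hk⟩ := hdense χ hχ (η / (B + 1)) (by positivity)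
  have hcont {χ : Euc m → ℝ} (hχ : ContDiff ℝ 1 χ) :
      Continuous fun x : U × Euc m × Euc n => fderiv ℝ χ x.2.1 (P.f x) :=
    continuous_fderiv_comp_apply hχ (continuous_fst.comp continuous_snd) hP.f_cont
  have hclose : ∀ u, ∀ y ∈ P.Y, ∀ z ∈ P.Z,
      ‖fderiv ℝ χ y (P.f (u, y, z)) - fderiv ℝ (φ k) y (P.f (u, y, z))‖ ≤ η := by
    intro u y hy z hz
    calc ‖fderiv ℝ χ y (P.f (u, y, z)) - fderiv ℝ (φ k) y (P.f (u, y, z))‖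
        ≤ ‖fderiv ℝ χ y - fderiv ℝ (φ k) y‖ * ‖P.f (u, y, z)‖ :=
          (fderiv ℝ χ y - fderiv ℝ (φ k) y).le_opNorm _
      _ ≤ η / (B + 1) * (B + 1) :=
          mul_le_mul (hk y hy) ((hB u y hy z hz).trans (by simp)) (norm_nonneg _) (by positivity)
      _ = η := div_mul_cancel₀ _ (by positivity)
  have havg := hP.norm_avg_sub_avg_le (hcont hχ) (hcont (hφ k)) hclose ν ζ
  rwa [hν k, sub_zero, ← zero_add η] at havg

section SlowFirst

variable {γ : ProbabilityMeasure (U × P.Y × P.Z)}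

omit [MetricSpace U] [CompactSpace U] [BorelSpace U] in
theorem measurable_slowFirst : Measurable
    fun x : U × P.Y × P.Z => ((x.2.2 : Euc n), (x.1, x.2.1)) := by
  fun_prop

/-- A measure on `U × Y × Z` with the slow variable moved to the front, as a measure on
`ℝⁿ × (U × Y)`: it is then disintegrated with respect to the slow variable. -/
noncomputable def slowFirst (γ : ProbabilityMeasure (U × P.Y × P.Z)) :
    Measure (Euc n × (U × P.Y)) :=
  (γ : Measure (U × P.Y × P.Z)).map fun x => ((x.2.2 : Euc n), (x.1, x.2.1))

instance : IsProbabilityMeasure (slowFirst γ) :=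
  Measure.isProbabilityMeasure_map measurable_slowFirst.aemeasurable

omit [CompactSpace U] [BorelSpace U] in
theorem ae_slowFirst_fst_mem (hP : P.Standing) : ∀ᵐ ζ ∂(slowFirst γ).fst, ζ ∈ P.Z := by
  rw [slowFirst, Measure.fst, Measure.map_map measurable_fst measurable_slowFirst]
  exact (ae_map_iff (p := (· ∈ P.Z)) (measurable_fst.comp measurable_slowFirst).aemeasurable
    hP.Z_compact.measurableSet).2 (Eventually.of_forall fun x => x.2.2.2)

variable {p : U × Euc m × Euc n → ℝ}

omit [CompactSpace U] in
theorem aestronglyMeasurable_slowFirst [SecondCountableTopology U] (hp : Continuous p) :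
    AEStronglyMeasurable (fun x : Euc n × (U × P.Y) => p (x.2.1, (x.2.2 : Euc m), x.1))
      (slowFirst γ) :=
  (by fun_prop : Continuous fun x : Euc n × (U × P.Y) =>
    p (x.2.1, (x.2.2 : Euc m), x.1)).aestronglyMeasurable

theorem integrable_slowFirst (hP : P.Standing) (hp : Continuous p) :
    Integrable (fun x : Euc n × (U × P.Y) => p (x.2.1, (x.2.2 : Euc m), x.1)) (slowFirst γ) :=
  (integrable_map_measure (aestronglyMeasurable_slowFirst hp)
    measurable_slowFirst.aemeasurable).2 (hP.integrable_triple hp γ)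

theorem integral_slowFirst (hp : Continuous p) :
    ∫ x, p (x.2.1, (x.2.2 : Euc m), x.1) ∂slowFirst γ = P.mean p γ :=
  integral_map measurable_slowFirst.aemeasurable (aestronglyMeasurable_slowFirst hp)

variable [Nonempty (U × P.Y)]

theorem IsOccupationalSolution.ae_integral_condKernel_fderiv (hP : P.Standing)
    [StandardBorelSpace (U × P.Y)]
    (hγ : P.IsOccupationalSolution 0 γ) {φ : Euc m → ℝ} (hφ : ContDiff ℝ 1 φ) :
    ∀ᵐ ζ ∂(slowFirst γ).fst, ∫ w, fderiv ℝ φ (w.2 : Euc m) (P.f (w.1, (w.2 : Euc m), ζ))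
      ∂(slowFirst γ).condKernel ζ = 0 := by
  have hd : Continuous fun x : U × Euc m × Euc n => fderiv ℝ φ x.2.1 (P.f x) :=
    continuous_fderiv_comp_apply hφ (continuous_fst.comp continuous_snd) hP.f_cont
  refine ae_integral_condKernel_eq_zero (integrable_slowFirst hP hd) fun ψ hψ _ => ?_
  have hprod (x : U × Euc m × Euc n) : fderiv ℝ (fun w : Euc m × Euc n => ψ w.2 * φ w.1) x.2
      (P.f x, 0) = ψ x.2.2 * fderiv ℝ φ x.2.1 (P.f x) := by
    have hφ' := (hφ.differentiable one_ne_zero x.2.1).hasFDerivAt.comp x.2 hasFDerivAt_fst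
    have hψ' := (hψ.differentiable one_ne_zero x.2.2).hasFDerivAt.comp x.2 hasFDerivAt_snd
    have hd' : HasFDerivAt (fun w : Euc m × Euc n => ψ w.2 * φ w.1) _ x.2 := hψ'.mul hφ'
    simp [hd'.fderiv]
  have hfast := hγ.fast (fun w => ψ w.2 * φ w.1)
    ((hψ.comp contDiff_snd).mul (hφ.comp contDiff_fst))
  simp only [hprod, zero_mul] at hfast
  rw [← hfast, ← integral_slowFirst (p := fun x => ψ x.2.2 * fderiv ℝ φ x.2.1 (P.f x))
    ((hψ.continuous.comp (continuous_snd.comp continuous_snd)).mul hd)]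

theorem IsOccupationalSolution.ae_condKernel_mem_limitSet (hP : P.Standing)
    [StandardBorelSpace (U × P.Y)]
    (hγ : P.IsOccupationalSolution 0 γ) :
    ∀ᵐ ζ ∂(slowFirst γ).fst, ∃ hζ : ζ ∈ P.Z,
      ⟨(slowFirst γ).condKernel ζ, inferInstance⟩ ∈ P.limitSet ⟨ζ, hζ⟩ := by
  obtain ⟨φ, hφ, hmem⟩ := hP.exists_seq_mem_limitSet
  filter_upwards [ae_slowFirst_fst_mem hP,
    ae_all_iff.2 fun k => hγ.ae_integral_condKernel_fderiv hP (hφ k)] with ζ hζ hzero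
  exact ⟨hζ, hmem ⟨ζ, hζ⟩ _ hzero⟩

end SlowFirst

theorem IsOccupationalSolution.exists_graph_measure (hP : P.Standing)
    {γ : ProbabilityMeasure (U × P.Y × P.Z)} (hγ : P.IsOccupationalSolution 0 γ) :
    ∃ ρ : ProbabilityMeasure P.graphW, ∀ p : U × Euc m × Euc n → ℝ, Continuous p →
      ∫ x : P.graphW, P.avg p x.1.1 x.1.2 ∂(ρ : Measure P.graphW) = P.mean p γ := by
  have := hP.compactSpace_Y
  have : Nonempty (U × P.Y) :=
    (nonempty_of_isProbabilityMeasure (γ : Measure (U × P.Y × P.Z))).map fun x => (x.1, x.2.1)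
  obtain ⟨r, hr, hrid, hrW⟩ := exists_measurable_ae_eq_forall (hγ.ae_condKernel_mem_limitSet hP)
  choose hrZ hrW using hrW
  let T : Euc n → P.graphW := fun ζ =>
    ⟨(⟨(slowFirst γ).condKernel (r ζ), inferInstance⟩, ⟨r ζ, hrZ ζ⟩), hrW ζ⟩
  have hT : Measurable T := ((((slowFirst γ).condKernel.measurable.comp hr).subtype_mk).prodMk
    hr.subtype_mk).subtype_mk
  refine ⟨⟨(slowFirst γ).fst.map T, Measure.isProbabilityMeasure_map hT.aemeasurable⟩,
    fun p hp => ?_⟩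
  change ∫ x : P.graphW, P.avg p x.1.1 x.1.2 ∂((slowFirst γ).fst.map T) = _
  rw [integral_map hT.aemeasurable (stronglyMeasurable_avg hp).aestronglyMeasurable,
    ← integral_slowFirst hp, ← Measure.integral_condKernel (integrable_slowFirst hP hp)]
  refine integral_congr_ae ?_
  filter_upwards [hrid] with ζ hζ
  simp only [avg, T, hζ]
  rfl

end SPProblem

namespace SPProblem

variable {U : Type*} {m n : ℕ} [MetricSpace U] [MeasurableSpace U] {P : SPProblem U m n}

omit [MetricSpace U] in
theorem lpValue_le {B : ℝ} (hB : ∀ u, ∀ y ∈ P.Y, ∀ z ∈ P.Z, ‖P.G (u, y, z)‖ ≤ B)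
    {ρ : ProbabilityMeasure P.graphW} (hρ : ρ ∈ P.lpFeasible) :
    P.lpValue ≤ ∫ x : P.graphW, P.avg P.G x.1.1 x.1.2 ∂(ρ : Measure P.graphW) := by
  refine csInf_le ⟨-B, ?_⟩ ⟨ρ, hρ, rfl⟩
  rintro _ ⟨ρ', -, rfl⟩
  have hbound := norm_integral_le_of_norm_le_const (μ := (ρ' : Measure P.graphW))
    (f := fun x => P.avg P.G x.1.1 x.1.2) (Eventually.of_forall fun x => norm_avg_le hB _ _)
  rw [probReal_univ, mul_one] at hbound
  exact (abs_le.1 hbound).1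

omit [MetricSpace U] [MeasurableSpace U] in
theorem abs_cost_le {B : ℝ} {u : ℝ → U} {y : ℝ → Euc m} {z : ℝ → Euc n} (hC : 0 < P.C)
    (hB : ∀ u, ∀ y ∈ P.Y, ∀ z ∈ P.Z, ‖P.G (u, y, z)‖ ≤ B)
    (hin : ∀ t, 0 ≤ t → y t ∈ P.Y ∧ z t ∈ P.Z) : |P.cost u y z| ≤ P.C⁻¹ * B := by
  rw [← integral_exp_neg_mul hC, ← integral_mul_const]
  refine norm_integral_le_of_norm_le (f := fun t => Real.exp (-(P.C * t)) * P.G (u t, y t, z t))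
    ((integrableOn_exp_neg_mul hC).mul_const _) ?_
  filter_upwards [ae_restrict_mem measurableSet_Ioi] with t (ht : 0 < t)
  rw [norm_mul, Real.norm_of_nonneg (Real.exp_pos _).le]
  gcongr
  exact hB _ _ (hin t ht.le).1 _ (hin t ht.le).2

section CompactControls

variable [CompactSpace U]

theorem Standing.eventually_value_le_cost (hP : P.Standing) :
    ∀ᶠ ε in 𝓝[>] (0 : ℝ), ∀ u y z, P.IsSPTriple ε u y z → P.value ε ≤ P.cost u y z := by
  obtain ⟨B, hB⟩ := hP.exists_norm_le hP.G_cont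
  filter_upwards [hP.invariant] with ε hin u y z h
  refine csInf_le ⟨-(P.C⁻¹ * B), ?_⟩ ⟨u, y, z, h, rfl⟩
  rintro _ ⟨u', y', z', h', rfl⟩
  exact (abs_le.1 (abs_cost_le hP.C_pos hB (hin _ _ _ h'))).1

variable [BorelSpace U]

theorem Standing.fderiv_avg_add (hP : P.Standing) {ψ : Euc n → ℝ} (hψ : ContDiff ℝ 1 ψ)
    (ν : ProbabilityMeasure (U × P.Y)) (ζ : P.Z) (c : Euc n → ℝ) :
    fderiv ℝ ψ ζ (P.avg P.g ν ζ) + c ζ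
      = P.avg (fun x => fderiv ℝ ψ x.2.2 (P.g x) + c x.2.2) ν ζ := by
  have hd : Continuous fun x : U × Euc m × Euc n => fderiv ℝ ψ x.2.2 (P.g x) :=
    continuous_fderiv_comp_apply hψ (continuous_snd.comp continuous_snd) hP.g_cont
  have hint : Integrable (fun w : U × P.Y => fderiv ℝ ψ (ζ : Euc n) (P.g (w.1, (w.2 : Euc m), ζ)))
      (ν : Measure (U × P.Y)) := hP.integrable_section hd ν ζ
  simp only [avg]
  rw [integral_add hint (integrable_const _),
    ContinuousLinearMap.integral_comp_comm _ (hP.integrable_section hP.g_cont ν ζ),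
    integral_const, probReal_univ, one_smul]

namespace IsOccupationalSolution

variable {ε : ℝ} {γ : ProbabilityMeasure (U × P.Y × P.Z)}

theorem mean_fderiv_add (hγ : P.IsOccupationalSolution ε γ) (hP : P.Standing) {ψ : Euc n → ℝ}
    (hψ : ContDiff ℝ 1 ψ) :
    P.mean (fun x => fderiv ℝ ψ x.2.2 (P.g x) + P.C * (ψ P.z0 - ψ x.2.2)) γ = 0 := by
  have hd : Continuous fun x : U × Euc m × Euc n => fderiv ℝ ψ x.2.2 (P.g x) :=
    continuous_fderiv_comp_apply hψ (continuous_snd.comp continuous_snd) hP.g_cont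
  have hψc : Continuous fun x : U × Euc m × Euc n => ψ x.2.2 :=
    hψ.continuous.comp (continuous_snd.comp continuous_snd)
  have hintd : Integrable (fun x : U × P.Y × P.Z =>
      fderiv ℝ ψ (x.2.2 : Euc n) (P.g (x.1, (x.2.1 : Euc m), (x.2.2 : Euc n))))
      (γ : Measure (U × P.Y × P.Z)) := hP.integrable_triple hd _
  have hintψ : Integrable (fun x : U × P.Y × P.Z => ψ (x.2.2 : Euc n))
      (γ : Measure (U × P.Y × P.Z)) := hP.integrable_triple hψc _
  have hintsub : Integrable (fun x : U × P.Y × P.Z => P.C * (ψ P.z0 - ψ (x.2.2 : Euc n)))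
      (γ : Measure (U × P.Y × P.Z)) := ((integrable_const _).sub hintψ).const_mul _
  have hslow := hγ.slow ψ hψ
  simp only [mean] at hslow ⊢
  rw [integral_add hintd hintsub, integral_const_mul, integral_sub (integrable_const _) hintψ,
    hslow, integral_const, probReal_univ, one_smul]
  ring

theorem lpValue_le_mean (hγ : P.IsOccupationalSolution 0 γ) (hP : P.Standing) :
    P.lpValue ≤ P.mean P.G γ := by
  obtain ⟨B, hB⟩ := hP.exists_norm_le hP.G_cont
  obtain ⟨ρ, hρ⟩ := hγ.exists_graph_measure hP
  have hfeasible : ρ ∈ P.lpFeasible := by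
    intro ψ hψ
    have hd : Continuous fun x : U × Euc m × Euc n => fderiv ℝ ψ x.2.2 (P.g x) :=
      continuous_fderiv_comp_apply hψ (continuous_snd.comp continuous_snd) hP.g_cont
    have hψc := hψ.continuous
    simp only [hP.fderiv_avg_add hψ _ _ fun ζ => P.C * (ψ P.z0 - ψ ζ)]
    rw [hρ _ (by fun_prop), hγ.mean_fderiv_add hP hψ]
  exact (lpValue_le hB hfeasible).trans_eq (hρ P.G hP.G_cont)

end IsOccupationalSolution

theorem Standing.eventually_lt_mul_cost (hP : P.Standing) {c : ℝ} (hc : c < P.lpValue) :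
    ∀ᶠ ε in 𝓝[>] (0 : ℝ), ∀ u y z, P.IsSPTriple ε u y z → c < P.C * P.cost u y z := by
  by_contra! hcheap
  obtain ⟨γ, hγ, hle⟩ := hP.exists_isOccupationalSolution_zero
    (hP.frequently_exists_isOccupationalSolution hcheap)
  exact hc.not_ge ((hγ.lpValue_le_mean hP).trans hle)

theorem Standing.eventually_le_value_of_lt_lpValue (hP : P.Standing) {c : ℝ}
    (hc : P.C * c < P.lpValue) (hne : ∀ᶠ ε in 𝓝[>] (0 : ℝ), ∃ u y z, P.IsSPTriple ε u y z) :
    ∀ᶠ ε in 𝓝[>] (0 : ℝ), c ≤ P.value ε := by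
  filter_upwards [hP.eventually_lt_mul_cost hc, hne] with ε hlt ⟨u, y, z, h⟩
  refine le_csInf ⟨_, u, y, z, h, rfl⟩ ?_
  rintro _ ⟨u', y', z', h', rfl⟩
  exact (lt_of_mul_lt_mul_left (hlt u' y' z' h') hP.C_pos.le).le

theorem Standing.eventually_le_value_of_lt_avgValue (hP : P.Standing)
    (hval : Tendsto P.value (𝓝[>] 0) (𝓝 P.avgValue) ∨ P.C * P.avgValue = P.lpValue)
    (hne : ∀ᶠ ε in 𝓝[>] (0 : ℝ), ∃ u y z, P.IsSPTriple ε u y z) {c : ℝ} (hc : c < P.avgValue) :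
    ∀ᶠ ε in 𝓝[>] (0 : ℝ), c ≤ P.value ε := by
  rcases hval with hval | hval
  · exact (hval.eventually_const_lt hc).mono fun _ => le_of_lt
  · exact hP.eventually_le_value_of_lt_lpValue (hval ▸ mul_lt_mul_of_pos_left hc hP.C_pos) hne

end CompactControls

end SPProblem

section Limits

variable {ι : Type*} {l : Filter ι} {v w : ι → ℝ} {a : ℝ}

theorem tendsto_of_eventually_le_of_forall_lt (hw : Tendsto w l (𝓝 a)) (hle : ∀ᶠ i in l, v i ≤ w i)
    (hlower : ∀ c < a, ∀ᶠ i in l, c ≤ v i) : Tendsto v l (𝓝 a) := by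
  refine tendsto_order.2 ⟨fun c hc => ?_, fun c hc => ?_⟩
  · obtain ⟨c', hc', hlt⟩ := exists_between hc
    exact (hlower c' hlt).mono fun i h => hc'.trans_le h
  · filter_upwards [hle, hw.eventually_lt_const hc] with i hi hlt using hi.trans_lt hlt

theorem le_liminf_of_forall_lt [l.NeBot] (hw : Tendsto w l (𝓝 a)) (hle : ∀ᶠ i in l, v i ≤ w i)
    {b : ℝ} (hlower : ∀ c < b, ∀ᶠ i in l, c ≤ v i) : b ≤ liminf v l :=
  le_of_forall_lt_imp_le_of_dense fun c hc =>
    le_liminf_of_le (hw.isBoundedUnder_le.mono_le hle).isCoboundedUnder_ge (hlower c hc)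

end Limits

theorem mainTheorem3_general {U : Type*} [MetricSpace U] [CompactSpace U] [MeasurableSpace U]
    [BorelSpace U] {m n : ℕ} (P : SPProblem U m n) (hP : P.Standing)
    (q : ℕ → U × P.Y → ℝ) (hq : IsTestSequence q)
    (μ : P.Z → ProbabilityMeasure (U × P.Y)) (z : ℝ → P.Z) (hflow : P.IsAvgFlow μ z)
    (us : P.Y → P.Z → ℝ → U) (ys : P.Y → P.Z → ℝ → P.Y)
    (hsteer : P.IsUniformSteering q μ us ys)
    (hlip : ∀ p : U × Euc m × Euc n → ℝ, (∃ K : ℝ≥0, LipschitzWith K p) →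
      IsPiecewiseLipschitzNear (fun ζ => P.avg p (μ ζ) ζ) z)
    (L : ℝ) (hL : P.IsLipConstF L)
    (uε : ℝ → ℝ → U) (yε : ℝ → ℝ → P.Y) (zε : ℝ → ℝ → P.Z)
    (hconstr : ∀ᶠ ε in 𝓝[>] (0 : ℝ), P.IsConstructed L us ε (uε ε) (yε ε) (zε ε))
    (htube : P.StaysInTube μ z zε)
    (hval : Tendsto P.value (𝓝[>] 0) (𝓝 P.avgValue) ∨ P.C * P.avgValue = P.lpValue) :
    (P.IsOptimalACG μ z → P.IsAsympOptimal uε yε zε) ∧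
    ∀ α : ℝ, P.IsNearOptimalACG α μ z → P.IsAsympNearOptimal α uε yε zε := by
  have hsp := hconstr.mono fun _ h => h.1
  have hcost := SPProblem.tendsto_cost_avgCost hP hsp (SPProblem.eventually_stepSize_pos hL.1)
    (SPProblem.tendsto_stepSize hL.1) (hsteer.isAveragedAlongSamples hP hq hL hconstr) hflow
    htube hlip
  have hle : ∀ᶠ ε in 𝓝[>] (0 : ℝ), P.value ε
      ≤ P.cost (uε ε) (fun t => (yε ε t : Euc m)) (fun t => (zε ε t : Euc n)) := by
    filter_upwards [hP.eventually_value_le_cost, hsp] with ε hvalue h using hvalue _ _ _ h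
  have hlower : ∀ c < P.avgValue, ∀ᶠ ε in 𝓝[>] (0 : ℝ), c ≤ P.value ε := fun c hc =>
    hP.eventually_le_value_of_lt_avgValue hval (hsp.mono fun _ h => ⟨_, _, _, h⟩) hc
  refine ⟨fun hopt => ⟨_, hcost, ?_⟩, fun α hnear => ⟨_, hcost, ?_⟩⟩
  · exact tendsto_of_eventually_le_of_forall_lt hcost hle fun c hc => hlower c (hc.trans_eq hopt)
  · exact hnear.trans (add_le_add_left (le_liminf_of_forall_lt hcost hle hlower) α)

theorem mainTheorem3 {U : Type*} [MetricSpace U] [CompactSpace U] [MeasurableSpace U]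
    [BorelSpace U] {m n : ℕ} (P : SPProblem U m n) (hP : P.Standing)
    (q : ℕ → U × P.Y → ℝ) (hq : IsTestSequence q)
    (uz : P.Z → ℝ → U) (yz : P.Z → ℝ → P.Y)
    (μ : P.Z → ProbabilityMeasure (U × P.Y)) (z : ℝ → P.Z)
    (hACG : P.IsACGFamily uz yz μ z)
    (us : P.Y → P.Z → ℝ → U) (ys : P.Y → P.Z → ℝ → P.Y)
    (hsteer : P.IsUniformSteering q μ us ys)
    (hlip : P.IsWeaklyPiecewiseLipschitz μ z)
    (L : ℝ) (hL : P.IsLipConstF L)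
    (uε : ℝ → ℝ → U) (yε : ℝ → ℝ → P.Y) (zε : ℝ → ℝ → P.Z)
    (hconstr : ∀ᶠ ε in 𝓝[>] (0 : ℝ), P.IsConstructed L us ε (uε ε) (yε ε) (zε ε))
    (htube : P.StaysInTube μ z zε)
    (hval : Tendsto P.value (𝓝[>] 0) (𝓝 P.avgValue) ∨ P.C * P.avgValue = P.lpValue) :
    (P.IsOptimalACG μ z → P.IsAsympOptimal uε yε zε) ∧
    ∀ α : ℝ, 0 < α → P.IsNearOptimalACG α μ z → P.IsAsympNearOptimal α uε yε zε :=
  (mainTheorem3_general P hP q hq μ z hACG.flow us ys hsteer hlip.1 L hL uε yε zε hconstr htube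
    hval).imp_right fun hnear α _ => hnear α
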